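/- **Setting.** A linear array consists of $K$ subarrays with $M\ge 1$ elements each, $N=KM$ elements in total. Element $m$ of subarray $k$ has position $\varphi_{k,m}\in\mathbb{R}$. For frequencies $\omega_1=\omega_0$ and $\omega_2=\omega_0+\Delta\omega$ let $A\in\mathbb{C}^{N\times 2}$ be the steering matrix, with entries $A_{n,l}=e^{j\omega_l\varphi_n}$, and let $\Pi_A^\perp=I-A(A^HA)^{-1}A^H$. For $T$ snapshots with source coefficients $s_l(t_i)\in\mathbb{C}$ let $D_i\in\mathbb{C}^{N\times 2}$ have entries $[D_i]_{n,l}=j\varphi_ne^{j\omega_l\varphi_n}s_l(t_i)$, and put $$F=\sum_{i=1}^T\mathrm{Re}\{D_i^H\Pi_A^\perp D_i\},\qquad \mathrm{CRB}_{\rm FC}(\Delta\omega)=\tfrac12\,\mathrm{trace}\Big(\tfrac{\sigma^2}{2}F^{-1}\Big),$$ the average Cramér–Rao bound of $(\omega_1,\omega_2)$ for the fully calibrated array with noise power $\sigma^2>0$, regarded as a function of $\Delta\omega$ for fixed $\omega_0$, positions and coefficients. Let $P_l=\sum_{i}|s_l(t_i)|^2$ and assume $P_1,P_2>0$. **Random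 geometry.** Let $D>0$ and $\Omega=2\pi/D$. The positions are random, and the subarray averages $\bar\varphi_k=\frac1M\sum_m\varphi_{k,m}$ are independent and uniformly distributed on $[0,D]$. There are fixed nominal displacements $\delta_{k,m}$ with $|\delta_{k,m}|\le D$ and a number $\eta\ge 0$ such that almost surely $|\varphi_{k,m}-\bar\varphi_k-\delta_{k,m}|\le\eta D$ for all $k,m$. (Rigid subarrays have $\eta=0$; taking $\delta=0$ and $\eta$ small says that each subarray is nearly a point.) **Proposition.** There are absolute constants $c,C>0$ such that, in every such setting, for all $\Delta\omega\ge\Omega$ with $\eta\,\Delta\omega D\le c$ and all $t\in(0,1]$, the following three statements hold simultaneously with probability at least $1-Ce^{-cKt^2}$ (their failure has outer probability at most $Ce^{-cKt^2}$): $A^HA$ is invertible; $F$ is positive definite; and $\mathrm{CRB}_{\rm FC}$ is differentiable at $\Delta\omega$ with $$\left|\frac{\partial\,\mathrm{CRB}_{\rm FC}(\Delta\omega)}{\partial\Delta\omega}\right|\le C\,\frac{\sigma^2}{ND}\left(\frac1{P_1}+\frac1{P_2}\right)\left(t+\frac{1}{\Delta\omega D}+\eta\,\Delta\omega D\right).$$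 -/

import Mathlib

noncomputable section

namespace ArrayCRB

open Matrix

variable {ι : Type*} [Fintype ι] [DecidableEq ι] {L T K M : ℕ}

/-- The steering matrix: `A n l = exp (j ω_l φ_n)`, for elements at positions `φ` on a line
and sources with spatial angular frequencies `ω`. -/
def steering (φ : ι → ℝ) (ω : Fin L → ℝ) : Matrix ι (Fin L) ℂ :=
  Matrix.of fun n l => Complex.exp (Complex.I * (ω l : ℂ) * (φ n : ℂ))

/-- The matrix whose `l`-th column is `(∂ a(ω_l) / ∂ ω_l) s_l`, where `a(ω_l)` is the `l`-th
column of the steering matrix and `s` holds the source coefficients of one snapshot. -/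
def steeringDeriv (φ : ι → ℝ) (ω : Fin L → ℝ) (s : Fin L → ℂ) : Matrix ι (Fin L) ℂ :=
  Matrix.of fun n l =>
    Complex.I * (φ n : ℂ) * Complex.exp (Complex.I * (ω l : ℂ) * (φ n : ℂ)) * s l

/-- The projection onto the orthogonal complement of the column space of the steering matrix:
`I - A (Aᴴ A)⁻¹ Aᴴ`. -/
def projPerp (φ : ι → ℝ) (ω : Fin L → ℝ) : Matrix ι ι ℂ :=
  1 - steering φ ω * ((steering φ ω)ᴴ * steering φ ω)⁻¹ * (steering φ ω)ᴴ

/-- The matrix `F = ∑_i Re (D_iᴴ Π D_i)` of the fully calibrated array, summed over the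
snapshots `i`; `s i l` is the coefficient of source `l` in snapshot `i`. -/
def fimFC (φ : ι → ℝ) (ω : Fin L → ℝ) (s : Fin T → Fin L → ℂ) : Matrix (Fin L) (Fin L) ℝ :=
  ∑ i, ((steeringDeriv φ ω (s i))ᴴ * projPerp φ ω * steeringDeriv φ ω (s i)).map Complex.re

/-- The Cramér–Rao bound matrix of `ω` for the fully calibrated array, with noise power `σ ^ 2`. -/
def crbFC (σ : ℝ) (φ : ι → ℝ) (ω : Fin L → ℝ) (s : Fin T → Fin L → ℂ) :
    Matrix (Fin L) (Fin L) ℝ :=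
  (σ ^ 2 / 2) • (fimFC φ ω s)⁻¹

/-- The frequencies of two sources with separation `Δω`. -/
def twoFreq (ω₀ Δω : ℝ) : Fin 2 → ℝ := ![ω₀, ω₀ + Δω]

/-- The average Cramér–Rao bound of two sources, as a function of their separation `Δω`. -/
def avgCrbFC (σ : ℝ) (φ : ι → ℝ) (s : Fin T → Fin 2 → ℂ) (ω₀ Δω : ℝ) : ℝ :=
  (crbFC σ φ (twoFreq ω₀ Δω) s 0 0 + crbFC σ φ (twoFreq ω₀ Δω) s 1 1) / 2

/-- The total power `∑_i |s_l(t_i)|²` of source `l` over the snapshots. -/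
def sourcePower (s : Fin T → Fin L → ℂ) (l : Fin L) : ℝ := ∑ i, ‖s i l‖ ^ 2

/-- The average position of the elements of subarray `k`; element `m` of subarray `k` is
indexed by `(k, m)`. -/
def subarrayMean (φ : Fin K × Fin M → ℝ) (k : Fin K) : ℝ := (∑ m, φ (k, m)) / (M : ℝ)

end ArrayCRB

end

/-!
Write `empirical φ` for the uniform distribution of the element positions. All entries of the Gram
matrix of the steering vectors and their derivatives are exponential moments
`∫ x ^ p * exp (I * z * x)` of this measure, with `z` a difference of frequencies. If these vectors
form a Riesz sequence in `L²(empirical φ)`, the Fisher information is well conditioned, and the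
slope of the bound is controlled by the moments at `z = ±Δω`: when those cross terms vanish, each
source sees a bound which does not depend on the other frequency.

For subarrays placed uniformly on an interval of length `D` the expected distribution is an average
of uniform distributions on such intervals. It has the Riesz property uniformly in `Δω`, by
compactness for bounded separations and by decay of the cross terms for large ones, and its moments
at `Δω` are `O(1 / (Δω D))` by integration by parts. Hoeffding's inequality over the subarrays
transfers both facts to the random array up to an error `t`, and the deviations of the elements from
their nominal displacements change the moments by `O(η Δω D)`.
-/

noncomputable section

namespace ArrayCRB

open Complex MeasureTheory ProbabilityTheory Matrix
open scoped ComplexConjugate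

section ExpMonomial

/-- The exponential monomial `x ^ p * exp (j z x)`: the entries of every Gram matrix of steering
vectors and of their frequency derivatives are averages of such functions. -/
def expMonomial (p : ℕ) (z x : ℝ) : ℂ := (x : ℂ) ^ p * exp (I * z * x)

lemma norm_expMonomial (p : ℕ) (z x : ℝ) : ‖expMonomial p z x‖ = |x| ^ p := by
  rw [expMonomial, norm_mul, norm_pow, norm_real, Real.norm_eq_abs,
    show I * z * x = ((z * x : ℝ) : ℂ) * I by push_cast; ring, norm_exp_ofReal_mul_I, mul_one]

lemma norm_expMonomial_le (p : ℕ) (z : ℝ) {x R : ℝ} (hx : |x| ≤ R) :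
    ‖expMonomial p z x‖ ≤ R ^ p := by
  rw [norm_expMonomial]
  exact pow_le_pow_left₀ (abs_nonneg x) hx p

lemma conj_expMonomial_mul (p q : ℕ) (y z x : ℝ) :
    conj (expMonomial p y x) * expMonomial q z x = expMonomial (p + q) (z - y) x := by
  simp only [expMonomial, map_mul, map_pow, conj_ofReal, ← exp_conj, conj_I]
  rw [mul_mul_mul_comm, ← pow_add, ← Complex.exp_add]
  congr 2
  push_cast
  ring

lemma continuous_expMonomial (p : ℕ) (z : ℝ) : Continuous (expMonomial p z) := by
  unfold expMonomial
  fun_prop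

lemma hasDerivAt_expMonomial_left (p : ℕ) (z x : ℝ) :
    HasDerivAt (expMonomial p · x) (I * expMonomial (p + 1) z x) z := by
  have h : HasDerivAt (fun z : ℝ => I * z * x) (I * 1 * x) z :=
    ((hasDerivAt_id z).ofReal_comp.const_mul I).mul_const _
  refine (h.cexp.const_mul ((x : ℂ) ^ p)).congr_deriv ?_
  rw [expMonomial]
  ring

lemma hasDerivAt_expMonomial (p : ℕ) (z x : ℝ) :
    HasDerivAt (expMonomial p z) (p * expMonomial (p - 1) z x + I * z * expMonomial p z x) x := by
  have h : HasDerivAt (fun x : ℝ => I * z * x) (I * z * 1) x :=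
    (hasDerivAt_id x).ofReal_comp.const_mul (I * (z : ℂ))
  have h' : HasDerivAt (fun x : ℝ => (x : ℂ) ^ p) (p * (x : ℂ) ^ (p - 1) * 1) x :=
    (hasDerivAt_id x).ofReal_comp.pow p
  refine (h'.mul h.cexp).congr_deriv ?_
  rw [expMonomial, expMonomial]
  ring

lemma norm_expMonomial_sub_le (p : ℕ) (z : ℝ) {x y R : ℝ} (hx : |x| ≤ R) (hy : |y| ≤ R) :
    ‖expMonomial p z x - expMonomial p z y‖ ≤ (p * R ^ (p - 1) + |z| * R ^ p) * |x - y| := by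
  refine (convex_Icc (-R) R).norm_image_sub_le_of_norm_hasDerivWithin_le
    (fun u _ => (hasDerivAt_expMonomial p z u).hasDerivWithinAt) (fun u hu => ?_)
    (abs_le.mp hy) (abs_le.mp hx)
  calc ‖p * expMonomial (p - 1) z u + I * z * expMonomial p z u‖
      ≤ p * ‖expMonomial (p - 1) z u‖ + |z| * ‖expMonomial p z u‖ :=
        (norm_add_le _ _).trans_eq (by simp)
    _ ≤ p * R ^ (p - 1) + |z| * R ^ p := by
        gcongr <;> exact norm_expMonomial_le _ _ (abs_le.mpr hu)

lemma abs_mul_norm_integral_expMonomial_le (p : ℕ) (z : ℝ) {a b R : ℝ} (hab : a ≤ b)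
    (ha : |a| ≤ R) (hb : |b| ≤ R) :
    |z| * ‖∫ x in a..b, expMonomial p z x‖ ≤ 2 * R ^ p + p * R ^ (p - 1) * (b - a) := by
  have hint (q : ℕ) : IntervalIntegrable (expMonomial q z) volume a b :=
    (continuous_expMonomial q z).intervalIntegrable _ _
  have hparts : I * z * ∫ x in a..b, expMonomial p z x =
      expMonomial p z b - expMonomial p z a - p * ∫ x in a..b, expMonomial (p - 1) z x := by
    rw [← intervalIntegral.integral_eq_sub_of_hasDerivAt
      (fun x _ => hasDerivAt_expMonomial p z x)
      (((hint _).const_mul _).add ((hint _).const_mul _)),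
      intervalIntegral.integral_add ((hint _).const_mul _) ((hint _).const_mul _),
      intervalIntegral.integral_const_mul, intervalIntegral.integral_const_mul]
    ring
  have hlow : ‖∫ x in a..b, expMonomial (p - 1) z x‖ ≤ R ^ (p - 1) * (b - a) := by
    rw [← abs_of_nonneg (sub_nonneg.mpr hab)]
    refine intervalIntegral.norm_integral_le_of_norm_le_const fun x hx => ?_
    rw [Set.uIoc_of_le hab] at hx
    exact norm_expMonomial_le _ _
      (abs_le.mpr ⟨(abs_le.mp ha).1.trans hx.1.le, hx.2.trans (abs_le.mp hb).2⟩)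
  calc |z| * ‖∫ x in a..b, expMonomial p z x‖
      = ‖I * z * ∫ x in a..b, expMonomial p z x‖ := by simp
    _ ≤ ‖expMonomial p z b‖ + ‖expMonomial p z a‖
        + p * ‖∫ x in a..b, expMonomial (p - 1) z x‖ := by
        rw [hparts]
        refine (norm_sub_le _ _).trans (add_le_add (norm_sub_le _ _) ?_)
        rw [norm_mul, Complex.norm_natCast]
    _ ≤ R ^ p + R ^ p + p * (R ^ (p - 1) * (b - a)) := by
        gcongr <;> exact norm_expMonomial_le _ _ ‹_›
    _ = 2 * R ^ p + p * R ^ (p - 1) * (b - a) := by ring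

end ExpMonomial

section ExpMoment

variable {ν : Measure ℝ} [IsFiniteMeasure ν] {R : ℝ}

/-- The moment `∫ x ^ p * exp (j z x) dν` of a measure `ν`: the derivative of order `p` of its
characteristic function, up to a power of `j`. -/
def expMoment (ν : Measure ℝ) (p : ℕ) (z : ℝ) : ℂ := ∫ x, expMonomial p z x ∂ν

lemma integrable_expMonomial (hν : ∀ᵐ x ∂ν, |x| ≤ R) (p : ℕ) (z : ℝ) :
    Integrable (expMonomial p z) ν :=
  .of_bound (continuous_expMonomial p z).aestronglyMeasurable (R ^ p)
    (hν.mono fun _ hx => norm_expMonomial_le p z hx)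

lemma norm_expMoment_le {ν : Measure ℝ} [IsProbabilityMeasure ν] (hν : ∀ᵐ x ∂ν, |x| ≤ R) (p : ℕ)
    (z : ℝ) : ‖expMoment ν p z‖ ≤ R ^ p :=
  (norm_integral_le_of_norm_le_const (hν.mono fun _ hx => norm_expMonomial_le p z hx)).trans_eq
    (by simp)

lemma hasDerivAt_expMoment (hν : ∀ᵐ x ∂ν, |x| ≤ R) (p : ℕ) (z : ℝ) :
    HasDerivAt (expMoment ν p) (I * expMoment ν (p + 1) z) z := by
  rw [expMoment, ← integral_const_mul]
  refine (hasDerivAt_integral_of_dominated_loc_of_deriv_le (s := Set.univ)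
    (bound := fun _ => R ^ (p + 1)) Filter.univ_mem
    (.of_forall fun z => (continuous_expMonomial p z).aestronglyMeasurable)
    (integrable_expMonomial hν p z)
    ((continuous_expMonomial _ z).aestronglyMeasurable.const_mul _) ?_
    (integrable_const _) (.of_forall fun x u _ => hasDerivAt_expMonomial_left p u x)).2
  filter_upwards [hν] with x hx u _
  simpa using norm_expMonomial_le (p + 1) u hx

end ExpMoment

section RieszBound

variable {L : ℕ} {ν ν' : Measure ℝ} [IsFiniteMeasure ν] [IsFiniteMeasure ν'] {ω ω' : Fin L → ℝ}
  {R r κ : ℝ}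

/-- The exponential polynomial with frequencies `ω` whose coefficients `w` are affine functions of
the position: the index `(a, l)` stands for `x ^ a * exp (j ω_l x)`. -/
def expPoly (ω : Fin L → ℝ) (w : Fin 2 × Fin L → ℂ) (x : ℝ) : ℂ :=
  ∑ i, w i * expMonomial i.1 (ω i.2) x

/-- `r` is a lower Riesz bound in `L²(ν)` of the functions `exp (j ω_l x)` and `x exp (j ω_l x)`,
which span the exponential polynomials. -/
def IsLowerRieszBound (ν : Measure ℝ) (ω : Fin L → ℝ) (r : ℝ) : Prop :=
  ∀ w, r * ∑ i, ‖w i‖ ^ 2 ≤ ∫ x, ‖expPoly ω w x‖ ^ 2 ∂ν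

/-- The Gram matrix in `L²(ν)` of the functions `exp (j ω_l x)` and `x exp (j ω_l x)`. -/
def blockGram (ν : Measure ℝ) (ω : Fin L → ℝ) : Matrix (Fin 2 × Fin L) (Fin 2 × Fin L) ℂ :=
  of fun i j => expMoment ν (i.1 + j.1) (ω j.2 - ω i.2)

lemma IsLowerRieszBound.mono {r' : ℝ} {ν : Measure ℝ} (h : IsLowerRieszBound ν ω r) (hr : r' ≤ r) :
    IsLowerRieszBound ν ω r' :=
  fun w => (mul_le_mul_of_nonneg_right hr (by positivity)).trans (h w)

lemma norm_sq_expPoly (ω : Fin L → ℝ) (w : Fin 2 × Fin L → ℂ) (x : ℝ) :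
    ((‖expPoly ω w x‖ ^ 2 : ℝ) : ℂ) =
      ∑ i, ∑ j, conj (w i) * w j * expMonomial (i.1 + j.1) (ω j.2 - ω i.2) x := by
  rw [ofReal_pow, ← conj_mul', expPoly, map_sum, Finset.sum_mul_sum]
  refine Finset.sum_congr rfl fun i _ => Finset.sum_congr rfl fun j _ => ?_
  rw [map_mul, mul_mul_mul_comm, conj_expMonomial_mul]

lemma continuous_expPoly (ω : Fin L → ℝ) (w : Fin 2 × Fin L → ℂ) : Continuous (expPoly ω w) :=
  continuous_finsetSum _ fun _ _ => (continuous_expMonomial _ _).const_mul _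

lemma integrable_norm_sq_expPoly (hν : ∀ᵐ x ∂ν, |x| ≤ R) (ω : Fin L → ℝ)
    (w : Fin 2 × Fin L → ℂ) : Integrable (fun x => ‖expPoly ω w x‖ ^ 2) ν := by
  have h : Integrable (fun x => ((‖expPoly ω w x‖ ^ 2 : ℝ) : ℂ)) ν := by
    simp_rw [norm_sq_expPoly]
    exact integrable_finsetSum _ fun i _ => integrable_finsetSum _ fun j _ =>
      (integrable_expMonomial hν _ _).const_mul _
  exact h.re

lemma star_dotProduct_blockGram_mulVec (hν : ∀ᵐ x ∂ν, |x| ≤ R) (ω : Fin L → ℝ)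
    (w : Fin 2 × Fin L → ℂ) :
    star w ⬝ᵥ blockGram ν ω *ᵥ w = ((∫ x, ‖expPoly ω w x‖ ^ 2 ∂ν : ℝ) : ℂ) := by
  have hint (i j : Fin 2 × Fin L) : Integrable (fun x => conj (w i) * w j *
      expMonomial (i.1 + j.1) (ω j.2 - ω i.2) x) ν :=
    (integrable_expMonomial hν _ _).const_mul _
  rw [← integral_complex_ofReal]
  simp_rw [norm_sq_expPoly]
  rw [integral_finsetSum _ fun i _ => integrable_finsetSum _ fun j _ => hint i j]
  simp_rw [integral_finsetSum _ fun j _ => hint _ j, integral_const_mul]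
  simp only [dotProduct, mulVec, Pi.star_apply, RCLike.star_def, Finset.mul_sum, blockGram,
    of_apply, expMoment]
  refine Finset.sum_congr rfl fun i _ => Finset.sum_congr rfl fun j _ => ?_
  ring

lemma isHermitian_blockGram (ν : Measure ℝ) (ω : Fin L → ℝ) : (blockGram ν ω).IsHermitian := by
  ext i j
  simp only [conjTranspose_apply, blockGram, of_apply, RCLike.star_def, expMoment, ← integral_conj]
  congr 1 with x
  rw [expMonomial, expMonomial, map_mul, map_pow, conj_ofReal, ← exp_conj, add_comm]
  simp only [map_mul, map_sub, conj_I, conj_ofReal, ofReal_sub]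
  ring_nf

lemma isLowerRieszBound_iff_re (hν : ∀ᵐ x ∂ν, |x| ≤ R) :
    IsLowerRieszBound ν ω r ↔
      ∀ w, r * ∑ i, ‖w i‖ ^ 2 ≤ (star w ⬝ᵥ blockGram ν ω *ᵥ w).re := by
  simp_rw [IsLowerRieszBound, star_dotProduct_blockGram_mulVec hν, ofReal_re]

lemma norm_star_dotProduct_mulVec_le {n : Type*} [Fintype n] {A : Matrix n n ℂ}
    (hA : ∀ i j, ‖A i j‖ ≤ κ) (w : n → ℂ) :
    ‖star w ⬝ᵥ A *ᵥ w‖ ≤ Fintype.card n * κ * ∑ i, ‖w i‖ ^ 2 := by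
  rcases isEmpty_or_nonempty n with hn | ⟨⟨k⟩⟩
  · simp
  have hκ : 0 ≤ κ := (norm_nonneg _).trans (hA k k)
  calc ‖star w ⬝ᵥ A *ᵥ w‖ ≤ ∑ i, ∑ j, ‖w i‖ * (κ * ‖w j‖) := by
        refine norm_sum_le_of_le _ fun i _ => ?_
        rw [mulVec, dotProduct, Finset.mul_sum]
        refine norm_sum_le_of_le _ fun j _ => ?_
        rw [norm_mul, norm_mul, Pi.star_apply, norm_star]
        gcongr
        exact hA i j
    _ = κ * (∑ i, ‖w i‖) ^ 2 := by
        rw [sq, Finset.sum_mul_sum, Finset.mul_sum]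
        refine Finset.sum_congr rfl fun i _ => ?_
        rw [Finset.mul_sum]
        exact Finset.sum_congr rfl fun j _ => by ring
    _ ≤ κ * (Fintype.card n * ∑ i, ‖w i‖ ^ 2) := by
        gcongr
        simpa using sq_sum_le_card_mul_sum_sq (s := Finset.univ) (f := fun i => ‖w i‖)
    _ = Fintype.card n * κ * ∑ i, ‖w i‖ ^ 2 := by ring

lemma le_re_star_dotProduct_mulVec_of_norm_sub_le {n : Type*} [Fintype n] {A B : Matrix n n ℂ}
    (h : ∀ i j, ‖A i j - B i j‖ ≤ κ) (w : n → ℂ) :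
    (star w ⬝ᵥ A *ᵥ w).re - Fintype.card n * κ * ∑ i, ‖w i‖ ^ 2 ≤ (star w ⬝ᵥ B *ᵥ w).re := by
  have hsub := (re_le_norm _).trans (norm_star_dotProduct_mulVec_le (A := A - B) h w)
  rw [sub_mulVec, dotProduct_sub, sub_re] at hsub
  linarith

lemma IsLowerRieszBound.of_norm_expMoment_sub_le (hr : IsLowerRieszBound ν ω r)
    (hν : ∀ᵐ x ∂ν, |x| ≤ R) (hν' : ∀ᵐ x ∂ν', |x| ≤ R)
    (h : ∀ p ≤ 2, ∀ l l', ‖expMoment ν p (ω l' - ω l) - expMoment ν' p (ω l' - ω l)‖ ≤ κ) :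
    IsLowerRieszBound ν' ω (r - 2 * L * κ) := by
  rw [isLowerRieszBound_iff_re hν] at hr
  rw [isLowerRieszBound_iff_re hν']
  intro w
  have hclose := le_re_star_dotProduct_mulVec_of_norm_sub_le (A := blockGram ν ω)
    (B := blockGram ν' ω) (fun i j => h _ (by omega) i.2 j.2) w
  simp only [Fintype.card_prod, Fintype.card_fin, Nat.cast_mul, Nat.cast_ofNat] at hclose
  linarith [hr w]

/-- Modulation by `exp (j ω₀ x)` does not change the modulus of an exponential polynomial. -/
lemma isLowerRieszBound_const_add_iff {ν : Measure ℝ} (ω₀ : ℝ) :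
    IsLowerRieszBound ν (fun l => ω₀ + ω l) r ↔ IsLowerRieszBound ν ω r := by
  have hmod (w : Fin 2 × Fin L → ℂ) (x : ℝ) :
      expPoly (fun l => ω₀ + ω l) w x = expMonomial 0 ω₀ x * expPoly ω w x := by
    rw [expPoly, expPoly, Finset.mul_sum]
    refine Finset.sum_congr rfl fun i _ => ?_
    simp only [expMonomial, ofReal_add, mul_add, add_mul, Complex.exp_add]
    ring
  simp only [IsLowerRieszBound, hmod, norm_mul, norm_expMonomial, pow_zero, one_mul]

lemma norm_expPoly_ite (ω ω' : Fin L → ℝ) (w : Fin 2 × Fin L → ℂ) (l : Fin L) (x : ℝ) :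
    ‖expPoly ω (fun i => if i.2 = l then w i else 0) x‖ =
      ‖expPoly ω' (fun i => if i.2 = l then w i else 0) x‖ := by
  have h (ω : Fin L → ℝ) : expPoly ω (fun i => if i.2 = l then w i else 0) x =
      exp (((ω l * x : ℝ) : ℂ) * I) * (w (0, l) + w (1, l) * x) := by
    simp only [expPoly, ite_mul, zero_mul, Fintype.sum_prod_type, Finset.sum_ite_eq',
      Finset.mem_univ, if_true, Fin.sum_univ_two, expMonomial]
    push_cast
    ring_nf
    simp
  simp only [h, norm_mul, norm_exp_ofReal_mul_I]

lemma sum_star_ite_dotProduct_mulVec {m n : Type*} [Fintype m] [Fintype n] [DecidableEq n]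
    (f : m → n) (A : Matrix m m ℂ) (w : m → ℂ) :
    ∑ l, star (fun i => if f i = l then w i else 0) ⬝ᵥ A *ᵥ (fun i => if f i = l then w i else 0) =
      star w ⬝ᵥ (of fun i j => if f i = f j then A i j else 0) *ᵥ w := by
  simp only [dotProduct, mulVec, Pi.star_apply, Finset.mul_sum, of_apply]
  rw [Finset.sum_comm]
  refine Finset.sum_congr rfl fun i _ => ?_
  rw [Finset.sum_comm]
  refine Finset.sum_congr rfl fun j _ => ?_
  rw [Finset.sum_eq_single (f i) (by simp +contextual [eq_comm]) (by simp)]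
  simp [eq_comm]

lemma sum_sum_norm_sq_ite {m n : Type*} [Fintype m] [Fintype n] [DecidableEq n] (f : m → n)
    (w : m → ℂ) : ∑ l, ∑ i, ‖if f i = l then w i else 0‖ ^ 2 = ∑ i, ‖w i‖ ^ 2 := by
  rw [Finset.sum_comm]
  refine Finset.sum_congr rfl fun i _ => ?_
  rw [Finset.sum_eq_single (f i) (by simp +contextual [eq_comm]) (by simp), if_pos rfl]

/-- The functions of a single frequency have the same Gram matrix for all frequencies, so only the
correlations between different frequencies matter. -/
lemma IsLowerRieszBound.of_norm_expMoment_le (hr : IsLowerRieszBound ν ω r)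
    (hν : ∀ᵐ x ∂ν, |x| ≤ R) (hκ : 0 ≤ κ)
    (h : ∀ p ≤ 2, ∀ l l', l ≠ l' → ‖expMoment ν p (ω' l' - ω' l)‖ ≤ κ) :
    IsLowerRieszBound ν ω' (r - 2 * L * κ) := by
  rw [isLowerRieszBound_iff_re hν]
  intro w
  have hclose := le_re_star_dotProduct_mulVec_of_norm_sub_le (B := blockGram ν ω')
    (A := of fun i j => if i.2 = j.2 then blockGram ν ω' i j else 0) (κ := κ)
    (fun i j => by
      by_cases hij : i.2 = j.2
      · simpa [hij] using hκ
      · simpa [hij, blockGram] using h _ (by omega) _ _ hij) w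
  have hdecoupled : r * ∑ i, ‖w i‖ ^ 2 ≤ (star w ⬝ᵥ
      (of fun i j => if i.2 = j.2 then blockGram ν ω' i j else 0) *ᵥ w).re := by
    rw [← sum_star_ite_dotProduct_mulVec, ← sum_sum_norm_sq_ite Prod.snd w, Finset.mul_sum, re_sum]
    refine Finset.sum_le_sum fun l _ => ?_
    rw [star_dotProduct_blockGram_mulVec hν, ofReal_re]
    simp_rw [norm_expPoly_ite ω' ω]
    exact hr _
  simp only [Fintype.card_prod, Fintype.card_fin, Nat.cast_mul, Nat.cast_ofNat] at hclose
  linarith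

end RieszBound

section Mixture

variable {ι : Type*} [Fintype ι] {ν : ι → Measure ℝ} {R : ℝ}

/-- The average of a finite family of measures. -/
def mixture (ν : ι → Measure ℝ) : Measure ℝ := (Fintype.card ι : ENNReal)⁻¹ • ∑ n, ν n

/-- The empirical measure of the element positions `φ`. -/
def empirical (φ : ι → ℝ) : Measure ℝ := mixture fun n => Measure.dirac (φ n)

instance [Nonempty ι] [∀ n, IsProbabilityMeasure (ν n)] : IsProbabilityMeasure (mixture ν) := by
  refine ⟨?_⟩
  simp [mixture, ENNReal.inv_mul_cancel]

instance [Nonempty ι] (φ : ι → ℝ) : IsProbabilityMeasure (empirical φ) := by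
  unfold empirical
  infer_instance

lemma ae_mixture {q : ℝ → Prop} (h : ∀ n, ∀ᵐ x ∂ν n, q x) : ∀ᵐ x ∂mixture ν, q x := by
  refine Measure.ae_smul_measure ?_ _
  rw [← Measure.sum_fintype, Measure.ae_sum_iff]
  exact h

lemma ae_empirical {φ : ι → ℝ} (hφ : ∀ n, |φ n| ≤ R) : ∀ᵐ x ∂empirical φ, |x| ≤ R :=
  ae_mixture fun n => (ae_dirac_iff (measurableSet_le (by fun_prop) (by fun_prop))).mpr (hφ n)

lemma integral_mixture {E : Type*} [NormedAddCommGroup E] [NormedSpace ℝ E] {f : ℝ → E}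
    (hf : ∀ n, Integrable f (ν n)) :
    ∫ x, f x ∂mixture ν = (Fintype.card ι : ℝ)⁻¹ • ∑ n, ∫ x, f x ∂ν n := by
  rw [mixture, integral_smul_measure, integral_finsetSum_measure fun n _ => hf n]
  simp

lemma expMoment_mixture [∀ n, IsFiniteMeasure (ν n)] (hν : ∀ n, ∀ᵐ x ∂ν n, |x| ≤ R) (p : ℕ)
    (z : ℝ) : expMoment (mixture ν) p z = (∑ n, expMoment (ν n) p z) / Fintype.card ι := by
  rw [expMoment, integral_mixture fun n => integrable_expMonomial (hν n) p z, real_smul,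
    div_eq_inv_mul]
  push_cast
  rfl

lemma expMoment_empirical (φ : ι → ℝ) (p : ℕ) (z : ℝ) :
    expMoment (empirical φ) p z = (∑ n, expMonomial p z (φ n)) / Fintype.card ι := by
  rw [empirical, expMoment, integral_mixture fun n => integrable_dirac (by simp), real_smul,
    div_eq_inv_mul]
  push_cast
  simp_rw [integral_dirac]

lemma IsLowerRieszBound.mixture {L : ℕ} {ω : Fin L → ℝ} {r : ℝ} [Nonempty ι]
    [∀ n, IsFiniteMeasure (ν n)] (h : ∀ n, IsLowerRieszBound (ν n) ω r)
    (hν : ∀ n, ∀ᵐ x ∂ν n, |x| ≤ R) : IsLowerRieszBound (mixture ν) ω r := by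
  intro w
  rw [integral_mixture fun n => integrable_norm_sq_expPoly (hν n) ω w, smul_eq_mul,
    inv_mul_eq_div, le_div_iff₀' (by exact_mod_cast Fintype.card_pos)]
  simpa using Finset.card_nsmul_le_sum Finset.univ _ _ fun n _ => h n w

end Mixture

section Interval

variable {A : ℝ}

instance isProbabilityMeasure_restrict_Icc_add_one (a : ℝ) :
    IsProbabilityMeasure (volume.restrict (Set.Icc a (a + 1))) :=
  ⟨by simp⟩

lemma ae_restrict_Icc_abs_le {a : ℝ} (ha : |a| ≤ A) :
    ∀ᵐ x ∂volume.restrict (Set.Icc a (a + 1)), |x| ≤ A + 1 := by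
  filter_upwards [ae_restrict_mem measurableSet_Icc] with x hx
  have := abs_le.mp ha
  exact abs_le.mpr ⟨by linarith [hx.1], by linarith [hx.2]⟩

lemma integral_restrict_Icc_add_one {E : Type*} [NormedAddCommGroup E] [NormedSpace ℝ E]
    (f : ℝ → E) (a : ℝ) :
    ∫ x, f x ∂volume.restrict (Set.Icc a (a + 1)) = ∫ x in a..a + 1, f x := by
  rw [intervalIntegral.integral_of_le (by linarith), integral_Icc_eq_integral_Ioc]

lemma abs_mul_norm_expMoment_restrict_Icc_le (p : ℕ) (z : ℝ) {a : ℝ} (ha : |a| ≤ A) :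
    |z| * ‖expMoment (volume.restrict (Set.Icc a (a + 1))) p z‖ ≤
      2 * (A + 1) ^ p + p * (A + 1) ^ (p - 1) := by
  rw [expMoment, integral_restrict_Icc_add_one]
  refine (abs_mul_norm_integral_expMonomial_le p z (R := A + 1) (by linarith)
    (ha.trans (by linarith)) ((abs_add_le a 1).trans (by simpa using ha))).trans_eq (by ring)

lemma analyticOnNhd_expPoly {L : ℕ} (ω : Fin L → ℝ) (w : Fin 2 × Fin L → ℂ) :
    AnalyticOnNhd ℝ (expPoly ω w) Set.univ := by
  intro x _
  have hx (x : ℝ) : AnalyticAt ℝ (fun x : ℝ => (x : ℂ)) x := ofRealCLM.analyticAt x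
  unfold expPoly expMonomial
  exact Finset.analyticAt_fun_sum _ fun i _ => analyticAt_const.mul (((hx x).pow _).mul
    ((analyticAt_cexp.restrictScalars (𝕜 := ℝ)).comp (analyticAt_const.mul (hx x))))

lemma expPoly_twoFreq_zero (w : Fin 2 × Fin 2 → ℂ) (y x : ℝ) :
    expPoly (twoFreq 0 y) w x =
      (w (0, 0) + w (1, 0) * x) + (w (0, 1) + w (1, 1) * x) * exp (I * y * x) := by
  simp [expPoly, expMonomial, twoFreq, Fintype.sum_prod_type]
  ring

/-- By the identity theorem the function vanishes on the whole line; on the multiples of half a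
period `τ` the exponential is `1` or `-1`. -/
lemma eq_zero_of_expPoly_twoFreq_eq_zero {y a b : ℝ} (hy : y ≠ 0) (hab : a < b)
    {w : Fin 2 × Fin 2 → ℂ} (h : ∀ x ∈ Set.Ioo a b, expPoly (twoFreq 0 y) w x = 0) : w = 0 := by
  have hzero (x : ℝ) : expPoly (twoFreq 0 y) w x = 0 := by
    obtain ⟨x₀, hx₀⟩ := Set.nonempty_Ioo.mpr hab
    exact (analyticOnNhd_expPoly _ w).eqOn_zero_of_preconnected_of_eventuallyEq_zero
      isPreconnected_univ (Set.mem_univ x₀)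
      (Filter.eventually_of_mem (Ioo_mem_nhds hx₀.1 hx₀.2) h) (Set.mem_univ x)
  simp only [expPoly_twoFreq_zero] at hzero
  have hπ : (Real.pi : ℂ) ≠ 0 := ofReal_ne_zero.mpr Real.pi_ne_zero
  have hy' : (y : ℂ) ≠ 0 := ofReal_ne_zero.mpr hy
  have hsample (k : ℕ) : (w (0, 0) + w (1, 0) * (k * (Real.pi / y))) +
      (w (0, 1) + w (1, 1) * (k * (Real.pi / y))) * (-1) ^ k = 0 := by
    have := hzero (k * (Real.pi / y))
    push_cast at this
    rwa [show I * y * (k * (Real.pi / y)) = k * (Real.pi * I) by field_simp, exp_nat_mul,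
      exp_pi_mul_I] at this
  have h0 := hsample 0
  have h1 := hsample 1
  have h2 := hsample 2
  have h3 := hsample 3
  have hτ : (Real.pi / y : ℂ) ≠ 0 := div_ne_zero hπ hy'
  push_cast at h0 h1 h2 h3
  generalize (Real.pi / y : ℂ) = τ at *
  have hsum : w (1, 0) + w (1, 1) = 0 :=
    (mul_eq_zero.mp (by linear_combination (h2 - h0) / 2)).resolve_right hτ
  have hdiff : w (1, 0) - w (1, 1) = 0 :=
    (mul_eq_zero.mp (by linear_combination (h3 - h1) / 2)).resolve_right hτ
  have hw10 : w (1, 0) = 0 := by linear_combination (hsum + hdiff) / 2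
  have hw11 : w (1, 1) = 0 := by linear_combination (hsum - hdiff) / 2
  rw [hw10, hw11] at h0 h1
  have hw00 : w (0, 0) = 0 := by linear_combination (h0 + h1) / 2
  have hw01 : w (0, 1) = 0 := by linear_combination (h0 - h1) / 2
  ext ⟨i, j⟩
  fin_cases i <;> fin_cases j <;> assumption

lemma exists_pos_forall_mul_norm_sq_le {X E : Type*} [TopologicalSpace X] [NormedAddCommGroup E]
    [NormedSpace ℝ E] [ProperSpace E] {S : Set X} (hS : IsCompact S) {q : X → E → ℝ}
    (hq : Continuous fun z : X × E => q z.1 z.2)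
    (hsmul : ∀ x (c : ℝ) w, q x (c • w) = c ^ 2 * q x w)
    (hpos : ∀ x ∈ S, ∀ w ≠ 0, 0 < q x w) :
    ∃ r > 0, ∀ x ∈ S, ∀ w, r * ‖w‖ ^ 2 ≤ q x w := by
  obtain ⟨r, hr, hmin⟩ := (hS.prod (isCompact_sphere (0 : E) 1)).exists_forall_le'
    hq.continuousOn (a := 0) fun z hz => hpos z.1 hz.1 z.2 (ne_zero_of_mem_unit_sphere ⟨z.2, hz.2⟩)
  refine ⟨r, hr, fun x hx w => ?_⟩
  rcases eq_or_ne w 0 with rfl | hw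
  · simpa using (hsmul x 0 0).ge
  have hunit := hmin (x, ‖w‖⁻¹ • w) ⟨hx, by simp [norm_smul, hw]⟩
  rw [hsmul, inv_pow, inv_mul_eq_div, le_div_iff₀ (by positivity)] at hunit
  exact hunit

lemma continuous_integral_norm_sq_expPoly_twoFreq :
    Continuous fun z : (ℝ × ℝ) × EuclideanSpace ℂ (Fin 2 × Fin 2) =>
      ∫ x in z.1.2..z.1.2 + 1, ‖expPoly (twoFreq 0 z.1.1) z.2 x‖ ^ 2 := by
  have hshift (z : (ℝ × ℝ) × EuclideanSpace ℂ (Fin 2 × Fin 2)) :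
      ∫ x in z.1.2..z.1.2 + 1, ‖expPoly (twoFreq 0 z.1.1) z.2 x‖ ^ 2 =
        ∫ x in (0 : ℝ)..1, ‖expPoly (twoFreq 0 z.1.1) z.2 (x + z.1.2)‖ ^ 2 := by
    rw [intervalIntegral.integral_comp_add_right (fun x => ‖expPoly (twoFreq 0 z.1.1) z.2 x‖ ^ 2),
      zero_add, add_comm 1]
  simp_rw [hshift, expPoly_twoFreq_zero]
  exact intervalIntegral.continuous_parametric_intervalIntegral_of_continuous' (by fun_prop) _ _

lemma integral_norm_sq_expPoly_twoFreq_pos {y a b : ℝ} (hy : y ≠ 0) (hab : a < b)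
    {w : Fin 2 × Fin 2 → ℂ} (hw : w ≠ 0) : 0 < ∫ x in a..b, ‖expPoly (twoFreq 0 y) w x‖ ^ 2 := by
  obtain ⟨x, hx, hne⟩ : ∃ x ∈ Set.Ioo a b, expPoly (twoFreq 0 y) w x ≠ 0 := by
    contrapose! hw
    exact eq_zero_of_expPoly_twoFreq_eq_zero hy hab hw
  exact intervalIntegral.integral_pos hab ((continuous_expPoly _ w).norm.pow 2).continuousOn
    (fun _ _ => by positivity) ⟨x, Set.Ioo_subset_Icc_self hx, by positivity⟩

lemma exists_isLowerRieszBound_twoFreq_of_le {y₀ : ℝ} (hy₀ : 0 < y₀) (A Y : ℝ) :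
    ∃ r > 0, ∀ y ∈ Set.Icc y₀ Y, ∀ a, |a| ≤ A →
      IsLowerRieszBound (volume.restrict (Set.Icc a (a + 1))) (twoFreq 0 y) r := by
  have hsmul (y x c : ℝ) (w : Fin 2 × Fin 2 → ℂ) :
      expPoly (twoFreq 0 y) (c • w) x = c * expPoly (twoFreq 0 y) w x := by
    simp [expPoly, Finset.mul_sum, mul_assoc]
  obtain ⟨r, hr, h⟩ := exists_pos_forall_mul_norm_sq_le
    (q := fun (z : ℝ × ℝ) (w : EuclideanSpace ℂ (Fin 2 × Fin 2)) =>
      ∫ x in z.2..z.2 + 1, ‖expPoly (twoFreq 0 z.1) w x‖ ^ 2)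
    ((isCompact_Icc (a := y₀) (b := Y)).prod (isCompact_Icc (a := -A) (b := A)))
    continuous_integral_norm_sq_expPoly_twoFreq
    (fun z c w => by simp [hsmul, mul_pow])
    (fun z hz w hw => integral_norm_sq_expPoly_twoFreq_pos (hy₀.trans_le hz.1.1).ne' (by simp)
      (by simpa using hw))
  refine ⟨r, hr, fun y hy a ha w => ?_⟩
  have := h (y, a) ⟨hy, abs_le.mp ha⟩ (WithLp.toLp 2 w)
  rwa [EuclideanSpace.norm_sq_eq, ← integral_restrict_Icc_add_one] at this

lemma abs_twoFreq_sub {l l' : Fin 2} (h : l ≠ l') (ω₀ y : ℝ) :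
    |twoFreq ω₀ y l' - twoFreq ω₀ y l| = |y| := by
  fin_cases l <;> fin_cases l' <;> simp_all [twoFreq]

/-- Bounded separations are handled by compactness; for large ones the two sources decouple. -/
theorem exists_isLowerRieszBound_twoFreq {y₀ : ℝ} (hy₀ : 0 < y₀) {A : ℝ} (hA : 0 ≤ A) :
    ∃ r > 0, ∀ y ≥ y₀, ∀ a, |a| ≤ A → ∀ ω₀,
      IsLowerRieszBound (volume.restrict (Set.Icc a (a + 1))) (twoFreq ω₀ y) r := by
  set B : ℝ := 4 * (A + 1) ^ 2
  have hosc (p : ℕ) (hp : p ≤ 2) : 2 * (A + 1) ^ p + p * (A + 1) ^ (p - 1) ≤ B := by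
    interval_cases p <;> simp only [B] <;> push_cast <;> nlinarith
  obtain ⟨r₁, hr₁, h₁⟩ := exists_isLowerRieszBound_twoFreq_of_le hy₀ A y₀
  obtain ⟨r₂, hr₂, h₂⟩ := exists_isLowerRieszBound_twoFreq_of_le hy₀ A (8 * B / r₁)
  refine ⟨min r₂ (r₁ / 2), by positivity, fun y hy a ha ω₀ => ?_⟩
  have htwo : twoFreq ω₀ y = fun l => ω₀ + twoFreq 0 y l := by
    ext l
    fin_cases l <;> simp [twoFreq]
  rw [htwo, isLowerRieszBound_const_add_iff]
  rcases le_or_gt y (8 * B / r₁) with hY | hY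
  · exact (h₂ y ⟨hy, hY⟩ a ha).mono (min_le_left _ _)
  have hy' : 0 < y := hy₀.trans_le hy
  refine ((h₁ y₀ ⟨le_rfl, le_rfl⟩ a ha).of_norm_expMoment_le (ω' := twoFreq 0 y) (κ := B / y)
    (ae_restrict_Icc_abs_le ha) (by positivity) fun p hp l l' hl => ?_).mono ?_
  · have hz : |twoFreq 0 y l' - twoFreq 0 y l| = y :=
      (abs_twoFreq_sub hl 0 y).trans (abs_of_pos hy')
    rw [le_div_iff₀' hy']
    nth_rewrite 1 [← hz]
    exact (abs_mul_norm_expMoment_restrict_Icc_le p _ ha).trans (hosc p hp)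
  · refine (min_le_right _ _).trans ?_
    rw [div_lt_iff₀ hr₁] at hY
    have : B / y ≤ r₁ / 8 := by rw [div_le_div_iff₀ hy' (by norm_num)]; linarith
    push_cast
    linarith

end Interval

section MatrixCalculus

variable {m n 𝕜 : Type*} [RCLike 𝕜] {y : ℝ}

lemma hasDerivAt_matrix_iff [Finite m] [Finite n] {A : ℝ → Matrix m n 𝕜} {A' : Matrix m n 𝕜} :
    HasDerivAt A A' y ↔ ∀ i j, HasDerivAt (fun z => A z i j) (A' i j) y := by
  have := Fintype.ofFinite m
  have := Fintype.ofFinite n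
  exact (hasDerivAt_pi (φ := fun z i => A z i) (φ' := fun i => A' i)).trans
    (forall_congr' fun _ => hasDerivAt_pi)

variable [Fintype n]

open scoped Matrix.Norms.Operator in
lemma hasDerivAt_matrix_mul {A B : ℝ → Matrix n n 𝕜} {A' B' : Matrix n n 𝕜}
    (hA : HasDerivAt A A' y) (hB : HasDerivAt B B' y) :
    HasDerivAt (fun z => A z * B z) (A' * B y + A y * B') y := by
  classical exact hA.mul hB

variable [DecidableEq n]

lemma matrix_inv_smul {c : 𝕜} (hc : c ≠ 0) (A : Matrix n n 𝕜) : (c • A)⁻¹ = c⁻¹ • A⁻¹ := by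
  by_cases hA : IsUnit A.det
  · exact inv_smul' A (Units.mk0 c hc) hA
  · have hcA : ¬ IsUnit (c • A).det := by
      rwa [det_smul, IsUnit.mul_iff, not_and_or, or_iff_right (not_not.mpr (hc.isUnit.pow _))]
    rw [nonsing_inv_apply_not_isUnit _ hA, nonsing_inv_apply_not_isUnit _ hcA, smul_zero]

open scoped Matrix.Norms.Operator in
lemma hasDerivAt_matrix_inv {A : ℝ → Matrix n n 𝕜} {A' : Matrix n n 𝕜}
    (hA : HasDerivAt A A' y) (hy : IsUnit (A y)) :
    HasDerivAt (fun z => (A z)⁻¹) (-((A y)⁻¹ * A' * (A y)⁻¹)) y := by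
  have h := (hasFDerivAt_ringInverse (𝕜 := ℝ) hy.unit).comp_hasDerivAt_of_eq y hA hy.unit_spec.symm
  simp only [Function.comp_def, ← nonsing_inv_eq_ringInverse] at h
  refine h.congr_deriv ?_
  rw [_root_.neg_apply, ContinuousLinearMap.mulLeftRight_apply, coe_units_inv, hy.unit_spec]

open scoped Matrix.Norms.Operator in
lemma matrix_norm_apply_le (A : Matrix n n 𝕜) (i j : n) : ‖A i j‖ ≤ ‖A‖ := by
  rw [linfty_opNorm_def, ← coe_nnnorm, NNReal.coe_le_coe]
  exact (Finset.single_le_sum (f := fun j => ‖A i j‖₊) (fun _ _ => zero_le)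
    (Finset.mem_univ j)).trans
    (Finset.le_sup (f := fun i => ∑ j, ‖A i j‖₊) (Finset.mem_univ i))

open scoped Matrix.Norms.Operator in
lemma matrix_norm_le_card_mul {A : Matrix n n 𝕜} {κ : ℝ} (hκ : 0 ≤ κ) (h : ∀ i j, ‖A i j‖ ≤ κ) :
    ‖A‖ ≤ Fintype.card n * κ := by
  lift κ to NNReal using hκ
  rw [linfty_opNorm_def]
  norm_cast
  refine Finset.sup_le fun i _ => ?_
  simpa using Finset.sum_le_card_nsmul Finset.univ _ κ fun j _ =>
    (NNReal.coe_le_coe.mp (h i j) : ‖A i j‖₊ ≤ κ)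

end MatrixCalculus

section Loewner

open scoped ComplexOrder MatrixOrder

variable {n 𝕜 : Type*} [RCLike 𝕜] {A B : Matrix n n 𝕜} {p : n → ℝ}

lemma posSemidef_map_re [Finite n] {A : Matrix n n ℂ} (hA : A.PosSemidef) :
    (A.map re).PosSemidef := by
  have := Fintype.ofFinite n
  refine .of_dotProduct_mulVec_nonneg ?_ fun x => ?_
  · ext i j
    simpa using congrArg re (hA.isHermitian.apply i j)
  · have hx := hA.re_dotProduct_nonneg fun i => (x i : ℂ)
    simpa [dotProduct, mulVec, Finset.mul_sum] using hx

variable [DecidableEq n]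

lemma diagonal_le_map_re [Finite n] {A : Matrix n n ℂ} (h : diagonal (fun i => (p i : ℂ)) ≤ A) :
    diagonal p ≤ A.map re := by
  rw [le_iff] at h ⊢
  have hsub : A.map re - diagonal p = (A - diagonal fun i => (p i : ℂ)).map re := by
    ext i j
    rcases eq_or_ne i j with rfl | hij <;> simp [*]
  exact hsub ▸ posSemidef_map_re h

lemma posDef_of_diagonal_le (hp : ∀ i, 0 < p i) (h : diagonal (fun i => (p i : 𝕜)) ≤ A) :
    A.PosDef := by
  have hdiag : (diagonal fun i => (p i : 𝕜)).PosDef :=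
    PosDef.diagonal fun i => RCLike.ofReal_pos.mpr (hp i)
  simpa using hdiag.add_posSemidef (le_iff.mp h)

lemma diagonal_mul_le_hadamard {Q S : Matrix n n 𝕜} {r : ℝ} (hQ : Q.PosSemidef)
    (hp : ∀ i, Q i i = p i) (hS : diagonal (fun _ => (r : 𝕜)) ≤ S) :
    diagonal (fun i => ((r * p i : ℝ) : 𝕜)) ≤ Q ⊙ S := by
  rw [le_iff] at hS ⊢
  convert hQ.hadamard hS using 1
  ext i j
  rcases eq_or_ne i j with rfl | hij
  · simp [hp, mul_sub, mul_comm]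
  · simp [hij]

variable [Fintype n]

lemma star_dotProduct_diagonal_mulVec (p : n → ℝ) (x : n → 𝕜) :
    star x ⬝ᵥ diagonal (fun i => (p i : 𝕜)) *ᵥ x = ((∑ i, p i * ‖x i‖ ^ 2 : ℝ) : 𝕜) := by
  simp only [dotProduct, mulVec_diagonal, Pi.star_apply, RCLike.star_def]
  push_cast
  refine Finset.sum_congr rfl fun i _ => ?_
  rw [← RCLike.conj_mul]
  ring

lemma sum_mul_norm_sq_le_re_of_diagonal_le (h : diagonal (fun i => (p i : 𝕜)) ≤ A) (x : n → 𝕜) :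
    ∑ i, p i * ‖x i‖ ^ 2 ≤ RCLike.re (star x ⬝ᵥ A *ᵥ x) := by
  have hx := (le_iff.mp h).re_dotProduct_nonneg x
  rw [sub_mulVec, dotProduct_sub, star_dotProduct_diagonal_mulVec, map_sub,
    RCLike.ofReal_re] at hx
  linarith

/-- Testing `A` on the columns of its inverse. -/
lemma sum_mul_norm_sq_inv_apply_le (hp : ∀ i, 0 < p i)
    (h : diagonal (fun i => (p i : 𝕜)) ≤ A) (j : n) :
    ∑ i, p i * ‖A⁻¹ i j‖ ^ 2 ≤ (p j)⁻¹ := by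
  have hunit := (isUnit_iff_isUnit_det _).mp (posDef_of_diagonal_le hp h).isUnit
  have htest : ∑ i, p i * ‖A⁻¹ i j‖ ^ 2 ≤ ‖A⁻¹ j j‖ := by
    refine (sum_mul_norm_sq_le_re_of_diagonal_le h (A⁻¹.col j)).trans ?_
    have hcol : A *ᵥ A⁻¹.col j = Pi.single j 1 := by
      rw [← mulVec_single_one, mulVec_mulVec, mul_nonsing_inv _ hunit, one_mulVec]
    rw [hcol, dotProduct_single_one]
    exact (RCLike.re_le_norm _).trans_eq (norm_star _)
  have hdiag : ‖A⁻¹ j j‖ ≤ (p j)⁻¹ := by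
    have hle : p j * ‖A⁻¹ j j‖ ^ 2 ≤ ‖A⁻¹ j j‖ := (Finset.single_le_sum
      (f := fun i => p i * ‖A⁻¹ i j‖ ^ 2) (fun i _ => mul_nonneg (hp i).le (sq_nonneg _))
      (Finset.mem_univ j)).trans htest
    rcases (norm_nonneg (A⁻¹ j j)).eq_or_lt with h0 | h0
    · exact h0 ▸ (inv_pos.mpr (hp j)).le
    · rw [sq, ← mul_assoc, mul_le_iff_le_one_left h0] at hle
      simpa using (le_inv_mul_iff₀ (hp j)).mpr hle
  exact htest.trans hdiag

lemma norm_inv_apply_le {r : ℝ} (hr : 0 < r) (h : diagonal (fun _ => (r : 𝕜)) ≤ A) (i j : n) :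
    ‖A⁻¹ i j‖ ≤ r⁻¹ := by
  have hle : r * ‖A⁻¹ i j‖ ^ 2 ≤ r⁻¹ := (Finset.single_le_sum
    (f := fun i => r * ‖A⁻¹ i j‖ ^ 2) (fun i _ => by positivity) (Finset.mem_univ i)).trans
    (sum_mul_norm_sq_inv_apply_le (p := fun _ => r) (fun _ => hr) h j)
  refine (sq_le_sq₀ (norm_nonneg _) (inv_nonneg.mpr hr.le)).mp ?_
  rwa [sq r⁻¹, ← div_eq_inv_mul, le_div_iff₀' hr]

/-- The diagonal entry is a quadratic form of `B` in a column of `A⁻¹`, and Cauchy-Schwarz with the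
weights `p` bounds it by the quadratic form of `A`. -/
lemma norm_inv_mul_mul_inv_apply_le {κ : ℝ} (hp : ∀ i, 0 < p i)
    (h : diagonal (fun i => (p i : 𝕜)) ≤ A) (hB : ∀ i k, ‖B i k‖ ≤ κ * (√(p i) * √(p k))) (j : n) :
    ‖(A⁻¹ * B * A⁻¹) j j‖ ≤ κ * Fintype.card n * (p j)⁻¹ := by
  have hκ : 0 ≤ κ := by
    have := (norm_nonneg _).trans (hB j j)
    exact nonneg_of_mul_nonneg_left this (by have := hp j; positivity)
  have hherm (i : n) : ‖A⁻¹ j i‖ = ‖A⁻¹ i j‖ := by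
    rw [← (posDef_of_diagonal_le hp h).isHermitian.inv.apply, norm_star]
  calc ‖(A⁻¹ * B * A⁻¹) j j‖
      ≤ ∑ k, ∑ i, κ * ((√(p i) * ‖A⁻¹ i j‖) * (√(p k) * ‖A⁻¹ k j‖)) := by
        rw [mul_apply]
        refine norm_sum_le_of_le _ fun k _ => ?_
        rw [mul_apply, Finset.sum_mul]
        refine norm_sum_le_of_le _ fun i _ => ?_
        rw [norm_mul, norm_mul, hherm]
        calc _ ≤ ‖A⁻¹ i j‖ * (κ * (√(p i) * √(p k))) * ‖A⁻¹ k j‖ := by gcongr; exact hB i k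
          _ = _ := by ring
    _ = κ * (∑ i, √(p i) * ‖A⁻¹ i j‖) ^ 2 := by
        rw [sq, Finset.sum_mul_sum, Finset.sum_comm]
        simp_rw [Finset.mul_sum]
    _ ≤ κ * (Fintype.card n * ∑ i, p i * ‖A⁻¹ i j‖ ^ 2) := by
        gcongr
        refine sq_sum_le_card_mul_sum_sq.trans_eq ?_
        simp only [mul_pow, Real.sq_sqrt (hp _).le, Finset.card_univ]
    _ ≤ κ * (Fintype.card n * (p j)⁻¹) := by
        gcongr
        exact sum_mul_norm_sq_inv_apply_le hp h j
    _ = κ * Fintype.card n * (p j)⁻¹ := by ring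

end Loewner

section SchurComplement

open scoped ComplexOrder MatrixOrder

variable {n : Type*} [DecidableEq n] {G : ℕ → Matrix n n ℂ} {r : ℝ}

lemma diagonal_le_of_diagonal_le_fromBlocks {A B C D : Matrix n n ℂ}
    (h : diagonal (fun _ => (r : ℂ)) ≤ fromBlocks A B C D) : diagonal (fun _ => (r : ℂ)) ≤ A := by
  rw [le_iff] at h ⊢
  convert h.submatrix Sum.inl using 1
  ext i j
  simp [diagonal_apply]

variable [Fintype n]

/-- The Schur complement of `G 0` in the block matrix with rows `G 0, G 1` and `G 1, G 2`. -/
def schurComplement (G : ℕ → Matrix n n ℂ) : Matrix n n ℂ := G 2 - G 1 * (G 0)⁻¹ * G 1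

lemma schurComplement_smul {c : ℂ} (hc : c ≠ 0) (G : ℕ → Matrix n n ℂ) :
    schurComplement (c • G) = c • schurComplement G := by
  simp only [schurComplement, Pi.smul_apply, matrix_inv_smul hc, smul_sub, smul_mul_assoc,
    mul_smul_comm, smul_smul]
  rw [inv_mul_cancel₀ hc, mul_one]

lemma diagonal_le_schurComplement (hr : 0 < r) (hG : (G 1).IsHermitian)
    (h : diagonal (fun _ => (r : ℂ)) ≤ fromBlocks (G 0) (G 1) (G 1) (G 2)) :
    diagonal (fun _ => (r : ℂ)) ≤ schurComplement G := by
  have hG₀ := posDef_of_diagonal_le (fun _ => hr) (diagonal_le_of_diagonal_le_fromBlocks h)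
  have hblock : (fromBlocks (G 0) (G 1) (G 1)ᴴ (G 2 - diagonal fun _ => (r : ℂ))).PosSemidef := by
    have htop : (diagonal (Sum.elim (fun _ => (r : ℂ)) 0 : n ⊕ n → ℂ)).PosSemidef :=
      .diagonal (by rintro (_ | _) <;> simp [hr.le])
    have hsum : fromBlocks (G 0) (G 1) (G 1)ᴴ (G 2 - diagonal fun _ => (r : ℂ)) =
        fromBlocks (G 0) (G 1) (G 1) (G 2) - diagonal (fun _ => (r : ℂ)) +
          diagonal (Sum.elim (fun _ => (r : ℂ)) 0) := by
      ext (i | i) (j | j) <;> simp [hG.eq, diagonal_apply]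
    exact hsum ▸ (le_iff.mp h).add htop
  let := hG₀.isUnit.invertible
  rw [hG₀.fromBlocks₁₁, hG.eq] at hblock
  rwa [le_iff, schurComplement, sub_right_comm]

open scoped Matrix.Norms.Operator in
lemma exists_hasDerivAt_schurComplement {G : ℝ → ℕ → Matrix n n ℂ} {G' : ℕ → Matrix n n ℂ}
    {y ε R : ℝ} (hr : 0 < r) (hR : 0 ≤ R) (h₀ : diagonal (fun _ => (r : ℂ)) ≤ G y 0)
    (hG : ∀ p, HasDerivAt (G · p) (G' p) y) (hG₁ : ∀ i j, ‖G y 1 i j‖ ≤ R)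
    (hε : 0 ≤ ε) (hG' : ∀ p ≤ 2, ∀ i j, ‖G' p i j‖ ≤ ε) :
    ∃ S', HasDerivAt (fun z => schurComplement (G z)) S' y ∧
      ∀ i j, ‖S' i j‖ ≤
        Fintype.card n * ε * (1 + Fintype.card n * R * (Fintype.card n * r⁻¹)) ^ 2 := by
  set N : ℝ := (Fintype.card n : ℝ)
  set W := (G y 0)⁻¹
  have hunit : IsUnit (G y 0) := (posDef_of_diagonal_le (fun _ => hr) h₀).isUnit
  have hW : ‖W‖ ≤ N * r⁻¹ := matrix_norm_le_card_mul (by positivity) (norm_inv_apply_le hr h₀)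
  have hg : ‖G y 1‖ ≤ N * R := matrix_norm_le_card_mul hR hG₁
  have hε' (p : ℕ) (hp : p ≤ 2) : ‖G' p‖ ≤ N * ε := matrix_norm_le_card_mul hε (hG' p hp)
  refine ⟨_, (hG 2).sub (hasDerivAt_matrix_mul
    (hasDerivAt_matrix_mul (hG 1) (hasDerivAt_matrix_inv (hG 0) hunit)) (hG 1)), fun i j => ?_⟩
  calc _ ≤ _ := matrix_norm_apply_le _ i j
    _ ≤ ‖G' 2‖ + ((‖G' 1‖ * ‖W‖ + ‖G y 1‖ * (‖W‖ * ‖G' 0‖ * ‖W‖)) * ‖G y 1‖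
        + ‖G y 1‖ * ‖W‖ * ‖G' 1‖) := by
      refine (norm_sub_le _ _).trans
        (add_le_add_right ((norm_add_le _ _).trans (add_le_add ?_ ?_)) _)
      · refine (norm_mul_le _ _).trans (mul_le_mul_of_nonneg_right ((norm_add_le _ _).trans
          (add_le_add (norm_mul_le _ _) ((norm_mul_le _ _).trans ?_))) (norm_nonneg _))
        rw [norm_neg]
        gcongr
        exact norm_mul₃_le
      · exact norm_mul₃_le
    _ ≤ N * ε + ((N * ε * (N * r⁻¹) + N * R * (N * r⁻¹ * (N * ε) * (N * r⁻¹))) * (N * R)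
        + N * R * (N * r⁻¹) * (N * ε)) := by
      gcongr <;> exact hε' _ (by norm_num)
    _ = N * ε * (1 + N * R * (N * r⁻¹)) ^ 2 := by ring

end SchurComplement

section FisherMatrix

open scoped ComplexOrder MatrixOrder

variable {n : Type*} {T : ℕ}

/-- The Gram matrix of the source coefficients; its diagonal entries are the source powers. -/
def crossPower (s : Fin T → n → ℂ) : Matrix n n ℂ := (of s)ᴴ * of s

lemma norm_crossPower_le (s : Fin T → n → ℂ) (i j : n) :
    ‖crossPower s i j‖ ≤ √(∑ k, ‖s k i‖ ^ 2) * √(∑ k, ‖s k j‖ ^ 2) := by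
  rw [← Real.sqrt_mul (by positivity)]
  refine Real.le_sqrt_of_sq_le ?_
  calc ‖crossPower s i j‖ ^ 2 ≤ (∑ k, ‖s k i‖ * ‖s k j‖) ^ 2 := by
        gcongr
        rw [crossPower, mul_apply]
        exact norm_sum_le_of_le _ fun k _ => by simp
    _ ≤ _ := Finset.sum_mul_sq_le_sq_mul_sq _ _ _

lemma crossPower_apply_self (s : Fin T → n → ℂ) (i : n) :
    crossPower s i i = (∑ k, ‖s k i‖ ^ 2 : ℝ) := by
  simp [crossPower, mul_apply, conj_mul']

variable [Fintype n] [DecidableEq n]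

/-- The information matrix of sources with coefficients `s`, where `G p` is the Gram matrix of
the steering vectors with weights `x ^ p`. -/
def fisherMatrix (s : Fin T → n → ℂ) (G : ℕ → Matrix n n ℂ) : Matrix n n ℝ :=
  (crossPower s ⊙ schurComplement G).map re

lemma diagonal_le_fisherMatrix {G : ℕ → Matrix n n ℂ} {r : ℝ} (s : Fin T → n → ℂ)
    (h : diagonal (fun _ => (r : ℂ)) ≤ schurComplement G) :
    diagonal (fun l => r * ∑ k, ‖s k l‖ ^ 2) ≤ fisherMatrix s G :=
  diagonal_le_map_re (diagonal_mul_le_hadamard (posSemidef_conjTranspose_mul_self _)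
    (crossPower_apply_self s) h)

lemma exists_hasDerivAt_fisherMatrix {s : Fin T → n → ℂ} {G : ℝ → ℕ → Matrix n n ℂ}
    {S' : Matrix n n ℂ} {y κ : ℝ} (hG : HasDerivAt (fun z => schurComplement (G z)) S' y)
    (hκ : ∀ i j, ‖S' i j‖ ≤ κ) :
    ∃ F', HasDerivAt (fun z => fisherMatrix s (G z)) F' y ∧
      ∀ i j, ‖F' i j‖ ≤ κ * (√(∑ k, ‖s k i‖ ^ 2) * √(∑ k, ‖s k j‖ ^ 2)) := by
  refine ⟨(crossPower s ⊙ S').map re, hasDerivAt_matrix_iff.mpr fun i j => ?_, fun i j => ?_⟩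
  · exact reCLM.hasFDerivAt.comp_hasDerivAt y
      ((hasDerivAt_matrix_iff.mp hG i j).const_mul (crossPower s i j))
  · calc ‖(crossPower s i j * S' i j).re‖ ≤ ‖S' i j‖ * ‖crossPower s i j‖ :=
        (abs_re_le_norm _).trans_eq (by rw [norm_mul, mul_comm])
      _ ≤ _ := mul_le_mul (hκ i j) (norm_crossPower_le s i j) (norm_nonneg _)
        ((norm_nonneg _).trans (hκ i j))

lemma exists_hasDerivAt_inv_apply {F : ℝ → Matrix n n ℝ} {F' : Matrix n n ℝ} {p : n → ℝ}
    {y κ : ℝ} (hp : ∀ i, 0 < p i) (hF : diagonal p ≤ F y) (hF' : HasDerivAt F F' y)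
    (hκ : ∀ i j, ‖F' i j‖ ≤ κ * (√(p i) * √(p j))) (j : n) :
    ∃ d, HasDerivAt (fun z => (F z)⁻¹ j j) d y ∧ |d| ≤ κ * Fintype.card n * (p j)⁻¹ := by
  refine ⟨_, hasDerivAt_matrix_iff.mp
    (hasDerivAt_matrix_inv hF' (posDef_of_diagonal_le hp hF).isUnit) j j, ?_⟩
  rw [Matrix.neg_apply, abs_neg]
  exact norm_inv_mul_mul_inv_apply_le hp hF hκ j

end FisherMatrix

section GramMat

open scoped ComplexOrder MatrixOrder

variable {ν : Measure ℝ} [IsFiniteMeasure ν] {L : ℕ} {r R : ℝ}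

/-- The Gram matrix in `L²(ν)` of the steering functions `exp (j ω_l x)` with weight `x ^ p`. -/
def gramMat (ν : Measure ℝ) (ω : Fin L → ℝ) (p : ℕ) : Matrix (Fin L) (Fin L) ℂ :=
  of fun l l' => expMoment ν p (ω l' - ω l)

lemma isHermitian_gramMat_one (ν : Measure ℝ) (ω : Fin L → ℝ) : (gramMat ν ω 1).IsHermitian := by
  ext l l'
  exact (isHermitian_blockGram ν ω).apply (0, l) (1, l')

lemma IsLowerRieszBound.diagonal_le_blockGram {ω : Fin L → ℝ} (h : IsLowerRieszBound ν ω r)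
    (hν : ∀ᵐ x ∂ν, |x| ≤ R) : diagonal (fun _ => (r : ℂ)) ≤ blockGram ν ω := by
  refine le_iff.mpr (.of_dotProduct_mulVec_nonneg
    ((isHermitian_blockGram ν ω).sub (isHermitian_diagonal_of_self_adjoint _ ?_)) fun w => ?_)
  · ext
    simp
  · have hdiag := star_dotProduct_diagonal_mulVec (𝕜 := ℂ) (fun _ => r) w
    rw [← Finset.mul_sum] at hdiag
    rw [sub_mulVec, dotProduct_sub, star_dotProduct_blockGram_mulVec hν]
    exact sub_nonneg.mpr (hdiag.trans_le (RCLike.ofReal_le_ofReal.mpr (h w)))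

lemma IsLowerRieszBound.diagonal_le_fromBlocks_gramMat {ω : Fin L → ℝ}
    (h : IsLowerRieszBound ν ω r) (hν : ∀ᵐ x ∂ν, |x| ≤ R) :
    diagonal (fun _ => (r : ℂ)) ≤
      fromBlocks (gramMat ν ω 0) (gramMat ν ω 1) (gramMat ν ω 1) (gramMat ν ω 2) := by
  have hsub := (le_iff.mp (h.diagonal_le_blockGram hν)).submatrix
    (Sum.elim (Prod.mk 0) (Prod.mk 1) : Fin L ⊕ Fin L → Fin 2 × Fin L)
  rw [le_iff]
  convert hsub using 1
  ext (i | i) (j | j) <;> simp [gramMat, blockGram, diagonal_apply]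

lemma hasDerivAt_gramMat (hν : ∀ᵐ x ∂ν, |x| ≤ R) {ω : ℝ → Fin L → ℝ} {ω' : Fin L → ℝ} {y : ℝ}
    (hω : ∀ l, HasDerivAt (ω · l) (ω' l) y) (p : ℕ) :
    HasDerivAt (fun z => gramMat ν (ω z) p)
      (of fun l l' => (ω' l' - ω' l) • (I * expMoment ν (p + 1) (ω y l' - ω y l))) y :=
  hasDerivAt_matrix_iff.mpr fun l l' =>
    (hasDerivAt_expMoment hν p _).scomp y ((hω l').sub (hω l))

end GramMat

section FisherInformation

open scoped ComplexOrder MatrixOrder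

variable {ι : Type*} {L T : ℕ}

/-- The matrix of the exponential monomials of order `p` at the element positions. -/
def monomialMatrix (φ : ι → ℝ) (ω : Fin L → ℝ) (p : ℕ) : Matrix ι (Fin L) ℂ :=
  of fun n l => expMonomial p (ω l) (φ n)

lemma steering_eq_monomialMatrix (φ : ι → ℝ) (ω : Fin L → ℝ) :
    steering φ ω = monomialMatrix φ ω 0 := by
  ext n l
  simp [steering, monomialMatrix, expMonomial]

lemma steeringDeriv_eq_monomialMatrix_mul (φ : ι → ℝ) (ω : Fin L → ℝ) (s : Fin L → ℂ) :
    steeringDeriv φ ω s = monomialMatrix φ ω 1 * diagonal fun l => I * s l := by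
  ext n l
  simp only [steeringDeriv, monomialMatrix, expMonomial, of_apply, mul_diagonal]
  ring

variable [Fintype ι] [Nonempty ι] (φ : ι → ℝ) (ω : Fin L → ℝ)

lemma conjTranspose_monomialMatrix_mul (p q : ℕ) :
    (monomialMatrix φ ω p)ᴴ * monomialMatrix φ ω q =
      (Fintype.card ι : ℂ) • gramMat (empirical φ) ω (p + q) := by
  ext l l'
  rw [Matrix.smul_apply, gramMat, of_apply, expMoment_empirical, smul_eq_mul,
    mul_div_cancel₀ _ (Nat.cast_ne_zero.mpr Fintype.card_ne_zero), mul_apply]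
  exact Finset.sum_congr rfl fun n _ => conj_expMonomial_mul p q _ _ _

lemma conjTranspose_steering_mul_self : (steering φ ω)ᴴ * steering φ ω =
    (Fintype.card ι : ℂ) • gramMat (empirical φ) ω 0 := by
  rw [steering_eq_monomialMatrix, conjTranspose_monomialMatrix_mul]

variable [DecidableEq ι]

lemma conjTranspose_monomialMatrix_mul_projPerp_mul :
    (monomialMatrix φ ω 1)ᴴ * projPerp φ ω * monomialMatrix φ ω 1 =
      (Fintype.card ι : ℂ) • schurComplement (gramMat (empirical φ) ω) := by
  rw [← schurComplement_smul (Nat.cast_ne_zero.mpr Fintype.card_ne_zero), projPerp,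
    Matrix.mul_sub, Matrix.sub_mul, Matrix.mul_one, steering_eq_monomialMatrix]
  simp only [schurComplement, Pi.smul_apply, ← conjTranspose_monomialMatrix_mul φ ω 0 0,
    ← conjTranspose_monomialMatrix_mul φ ω 1 1]
  nth_rewrite 1 [← conjTranspose_monomialMatrix_mul φ ω 1 0]
  rw [← conjTranspose_monomialMatrix_mul φ ω 0 1]
  simp only [Matrix.mul_assoc]

lemma fimFC_eq_smul_fisherMatrix (s : Fin T → Fin L → ℂ) :
    fimFC φ ω s = (Fintype.card ι : ℝ) • fisherMatrix s (gramMat (empirical φ) ω) := by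
  set S := schurComplement (gramMat (empirical φ) ω) with hS
  have hterm (i : Fin T) : (steeringDeriv φ ω (s i))ᴴ * projPerp φ ω * steeringDeriv φ ω (s i) =
      diagonal (fun l => star (I * s i l)) * ((Fintype.card ι : ℂ) • S) *
        diagonal fun l => I * s i l := by
    rw [steeringDeriv_eq_monomialMatrix_mul, conjTranspose_mul, diagonal_conjTranspose, hS,
      ← conjTranspose_monomialMatrix_mul_projPerp_mul]
    simp only [Matrix.mul_assoc]
    rfl
  ext l l'
  rw [fimFC, Matrix.sum_apply, Matrix.smul_apply, fisherMatrix, map_apply, hadamard_apply,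
    crossPower, mul_apply, Finset.sum_mul, re_sum, smul_eq_mul, Finset.mul_sum]
  refine Finset.sum_congr rfl fun i _ => ?_
  rw [map_apply, hterm, mul_diagonal, diagonal_mul, Matrix.smul_apply, smul_eq_mul,
    ← re_ofReal_mul]
  congr 1
  simp only [conjTranspose_apply, of_apply, RCLike.star_def, map_mul, conj_I, ofReal_natCast]
  linear_combination (-(Fintype.card ι * (conj (s i l) * s i l' * S l l'))) * I_mul_I

lemma crbFC_apply (σ : ℝ) (s : Fin T → Fin L → ℂ) (l l' : Fin L) :
    crbFC σ φ ω s l l' = σ ^ 2 / (2 * Fintype.card ι) *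
      (fisherMatrix s (gramMat (empirical φ) ω))⁻¹ l l' := by
  rw [crbFC, fimFC_eq_smul_fisherMatrix,
    matrix_inv_smul (Nat.cast_ne_zero.mpr Fintype.card_ne_zero), Matrix.smul_apply,
    Matrix.smul_apply, smul_smul, smul_eq_mul, ← div_eq_mul_inv, div_div]

end FisherInformation

section Slope

open scoped ComplexOrder MatrixOrder

variable {ι : Type*} [Fintype ι] [Nonempty ι] {φ : ι → ℝ} {L T : ℕ} {r R : ℝ}

lemma IsLowerRieszBound.det_conjTranspose_steering_mul_self_ne_zero {ω : Fin L → ℝ} (hr : 0 < r)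
    (h : IsLowerRieszBound (empirical φ) ω r) (hφ : ∀ n, |φ n| ≤ R) :
    ((steering φ ω)ᴴ * steering φ ω).det ≠ 0 := by
  have hpos := posDef_of_diagonal_le (fun _ => hr)
    (diagonal_le_of_diagonal_le_fromBlocks (h.diagonal_le_fromBlocks_gramMat (ae_empirical hφ)))
  rw [conjTranspose_steering_mul_self, det_smul]
  exact mul_ne_zero (pow_ne_zero _ (Nat.cast_ne_zero.mpr Fintype.card_ne_zero)) hpos.det_pos.ne'

lemma IsLowerRieszBound.diagonal_le_fisherMatrix {ω : Fin L → ℝ} (hr : 0 < r)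
    (h : IsLowerRieszBound (empirical φ) ω r) (hφ : ∀ n, |φ n| ≤ R) (s : Fin T → Fin L → ℂ) :
    diagonal (fun l => r * sourcePower s l) ≤ fisherMatrix s (gramMat (empirical φ) ω) :=
  ArrayCRB.diagonal_le_fisherMatrix s (diagonal_le_schurComplement hr (isHermitian_gramMat_one _ _)
    (h.diagonal_le_fromBlocks_gramMat (ae_empirical hφ)))

variable [DecidableEq ι]

lemma IsLowerRieszBound.posDef_fimFC {ω : Fin L → ℝ} (hr : 0 < r)
    (h : IsLowerRieszBound (empirical φ) ω r) (hφ : ∀ n, |φ n| ≤ R) {s : Fin T → Fin L → ℂ}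
    (hs : ∀ l, 0 < sourcePower s l) : (fimFC φ ω s).PosDef := by
  rw [fimFC_eq_smul_fisherMatrix]
  exact (posDef_of_diagonal_le (fun l => mul_pos hr (hs l))
    (h.diagonal_le_fisherMatrix hr hφ s)).smul (Nat.cast_pos.mpr Fintype.card_pos)

lemma IsLowerRieszBound.exists_hasDerivAt_crbFC {ω : ℝ → Fin L → ℝ} {ω' : Fin L → ℝ} {y ε : ℝ}
    (hr : 0 < r) (h : IsLowerRieszBound (empirical φ) (ω y) r) (hφ : ∀ n, |φ n| ≤ R)
    (hω : ∀ l, HasDerivAt (ω · l) (ω' l) y) (hε : 0 ≤ ε)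
    (hε' : ∀ p ≤ 2, ∀ l l',
      |ω' l' - ω' l| * ‖expMoment (empirical φ) (p + 1) (ω y l' - ω y l)‖ ≤ ε)
    (σ : ℝ) {s : Fin T → Fin L → ℂ} (hs : ∀ l, 0 < sourcePower s l) (l : Fin L) :
    ∃ d, HasDerivAt (fun z => crbFC σ φ (ω z) s l l) d y ∧
      |d| ≤ L ^ 2 * (1 + L * R * (L * r⁻¹)) ^ 2 / (2 * r ^ 2) *
        (σ ^ 2 / (Fintype.card ι * sourcePower s l)) * ε := by
  have hν := ae_empirical hφ
  have hblock := h.diagonal_le_fromBlocks_gramMat hν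
  have hR : 0 ≤ R := (abs_nonneg _).trans (hφ (Classical.arbitrary ι))
  have hG' (p : ℕ) (hp : p ≤ 2) (i j : Fin L) :
      ‖(ω' j - ω' i) • (I * expMoment (empirical φ) (p + 1) (ω y j - ω y i))‖ ≤ ε := by
    rw [norm_smul, norm_mul, norm_I, one_mul]
    exact hε' p hp i j
  obtain ⟨S', hS, hS'⟩ := exists_hasDerivAt_schurComplement
    (G := fun z => gramMat (empirical φ) (ω z)) hr hR
    (diagonal_le_of_diagonal_le_fromBlocks hblock) (hasDerivAt_gramMat hν hω)
    (fun _ _ => (norm_expMoment_le hν 1 _).trans_eq (pow_one R)) hε hG'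
  rw [Fintype.card_fin] at hS'
  set κ := L * ε * (1 + L * R * (L * r⁻¹)) ^ 2 with hκ
  obtain ⟨F', hF, hF'⟩ := exists_hasDerivAt_fisherMatrix (s := s) hS hS'
  have hF'' (i j : Fin L) :
      ‖F' i j‖ ≤ κ / r * (√(r * sourcePower s i) * √(r * sourcePower s j)) := by
    refine (hF' i j).trans_eq ?_
    rw [Real.sqrt_mul hr.le, Real.sqrt_mul hr.le, mul_mul_mul_comm √r, Real.mul_self_sqrt hr.le,
      ← mul_assoc (κ / r), div_mul_cancel₀ _ hr.ne']
    rfl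
  obtain ⟨d, hd, hd'⟩ := exists_hasDerivAt_inv_apply (fun l => mul_pos hr (hs l))
    (h.diagonal_le_fisherMatrix hr hφ s) hF hF'' l
  refine ⟨_, (hd.const_mul (σ ^ 2 / (2 * Fintype.card ι))).congr_of_eventuallyEq
    (.of_forall fun z => crbFC_apply φ (ω z) σ s l l), ?_⟩
  rw [abs_mul, abs_of_nonneg (by positivity)]
  calc _ ≤ σ ^ 2 / (2 * Fintype.card ι) *
        (κ / r * Fintype.card (Fin L) * (r * sourcePower s l)⁻¹) := by gcongr
    _ = _ := by
      rw [hκ, Fintype.card_fin]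
      field_simp

end Slope

section Hoeffding

variable {Ω : Type*} [MeasurableSpace Ω] {μ : Measure Ω} [IsProbabilityMeasure μ]
  {κ : Type*} [Fintype κ] {R ε : ℝ}

lemma hasSubgaussianMGF_sub_integral_of_abs_le {X : Ω → ℝ} (hm : AEMeasurable X μ)
    (hb : ∀ᵐ w ∂μ, |X w| ≤ R) : HasSubgaussianMGF (fun w => X w - μ[X]) (‖R‖₊ ^ 2) μ := by
  have h := hasSubgaussianMGF_of_mem_Icc hm (hb.mono fun w hw => abs_le.mp hw)
  rwa [sub_neg_eq_add, ← two_mul, nnnorm_mul, Real.nnnorm_two, mul_div_cancel_left₀ _ two_ne_zero]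
    at h

lemma measureReal_le_abs_sum_sub_integral_le {X : κ → Ω → ℝ} (hind : iIndepFun X μ)
    (hm : ∀ k, AEMeasurable (X k) μ) (hb : ∀ k, ∀ᵐ w ∂μ, |X k w| ≤ R) (hε : 0 ≤ ε) :
    μ.real {w | ε ≤ |∑ k, (X k w - μ[X k])|} ≤
      2 * Real.exp (-ε ^ 2 / (2 * (Fintype.card κ * R ^ 2))) := by
  have hsub (k : κ) := hasSubgaussianMGF_sub_integral_of_abs_le (hm k) (hb k)
  have hind' : iIndepFun (fun k w => X k w - μ[X k]) μ :=
    hind.comp (fun k x => x - ∫ w, X k w ∂μ) fun _ => measurable_id.sub_const _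
  have hupper := HasSubgaussianMGF.measure_sum_ge_le_of_iIndepFun hind' (s := Finset.univ)
    (fun k _ => hsub k) hε
  have hlower := HasSubgaussianMGF.measure_sum_ge_le_of_iIndepFun (s := Finset.univ)
    (hind'.comp (fun _ x => -x) fun _ => measurable_neg) (fun k _ => (hsub k).neg) hε
  have hparam : ((∑ _k : κ, ‖R‖₊ ^ 2 : NNReal) : ℝ) = Fintype.card κ * R ^ 2 := by simp
  rw [hparam] at hupper hlower
  calc _ ≤ μ.real ({w | ε ≤ ∑ k, (X k w - μ[X k])} ∪ {w | ε ≤ ∑ k, -(X k w - μ[X k])}) := by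
        refine measureReal_mono fun w hw => ?_
        rw [Set.mem_union, Set.mem_ofPred_eq, Set.mem_ofPred_eq, Finset.sum_neg_distrib]
        exact le_abs.mp hw
    _ ≤ _ := (measureReal_union_le _ _).trans ((add_le_add hupper hlower).trans_eq (two_mul _).symm)

lemma measureReal_le_norm_sum_sub_integral_le {Z : κ → Ω → ℂ} (hind : iIndepFun Z μ)
    (hm : ∀ k, AEMeasurable (Z k) μ) (hb : ∀ k, ∀ᵐ w ∂μ, ‖Z k w‖ ≤ R) (hε : 0 ≤ ε) :
    μ.real {w | ε ≤ ‖∑ k, (Z k w - μ[Z k])‖} ≤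
      4 * Real.exp (-ε ^ 2 / (4 * (Fintype.card κ * R ^ 2))) := by
  have hint (k : κ) : Integrable (Z k) μ := .of_bound (hm k).aestronglyMeasurable R (hb k)
  have hre := measureReal_le_abs_sum_sub_integral_le (X := fun k w => (Z k w).re) (ε := ε / √2)
    (hind.comp (fun _ => re) fun _ => measurable_re)
    (fun k => measurable_re.comp_aemeasurable (hm k))
    (fun k => (hb k).mono fun w hw => (abs_re_le_norm _).trans hw) (by positivity)
  have him := measureReal_le_abs_sum_sub_integral_le (X := fun k w => (Z k w).im) (ε := ε / √2)
    (hind.comp (fun _ => im) fun _ => measurable_im)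
    (fun k => measurable_im.comp_aemeasurable (hm k))
    (fun k => (hb k).mono fun w hw => (abs_im_le_norm _).trans hw) (by positivity)
  have hexp : -(ε / √2) ^ 2 / (2 * (Fintype.card κ * R ^ 2)) =
      -ε ^ 2 / (4 * (Fintype.card κ * R ^ 2)) := by
    rw [div_pow, Real.sq_sqrt zero_le_two, neg_div', div_div, ← mul_assoc]
    norm_num
  rw [hexp] at hre him
  calc _ ≤ μ.real ({w | ε / √2 ≤ |∑ k, ((Z k w).re - μ[fun w => (Z k w).re])|} ∪
        {w | ε / √2 ≤ |∑ k, ((Z k w).im - μ[fun w => (Z k w).im])|}) := by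
        refine measureReal_mono fun w hw => ?_
        have hmax := (div_le_iff₀' (by positivity)).mpr
          (hw.trans (Complex.norm_le_sqrt_two_mul_max _))
        rw [le_max_iff, re_sum, im_sum] at hmax
        have hμre (k : κ) : μ[fun w => (Z k w).re] = (μ[Z k]).re := integral_re (hint k)
        have hμim (k : κ) : μ[fun w => (Z k w).im] = (μ[Z k]).im := integral_im (hint k)
        simpa only [Set.mem_union, Set.mem_ofPred_eq, hμre, hμim, sub_re, sub_im] using hmax
    _ ≤ _ := (measureReal_union_le _ _).trans ((add_le_add hre him).trans_eq (by ring))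

end Hoeffding

section MomentConcentration

variable {Ω : Type*} [MeasurableSpace Ω] {μ : Measure Ω} [IsProbabilityMeasure μ]
  {κ β : Type*} [Fintype κ] [Nonempty κ] [Fintype β] [Nonempty β] {X : κ × β → Ω → ℝ} {R ε : ℝ}

/-- Only the subarrays are independent, so the bounded independent summands of Hoeffding's
inequality are the contributions of the whole subarrays. -/
lemma measureReal_le_norm_expMoment_empirical_sub_le
    (hind : iIndepFun (fun k w m => X (k, m) w) μ) (hm : ∀ n, AEMeasurable (X n) μ)
    (hb : ∀ n, ∀ᵐ w ∂μ, |X n w| ≤ R) (hε : 0 ≤ ε) (p : ℕ) (z : ℝ) :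
    μ.real {w | ε ≤ ‖expMoment (empirical (X · w)) p z -
        expMoment (mixture fun n => μ.map (X n)) p z‖} ≤
      4 * Real.exp (-(Fintype.card κ * ε ^ 2) / (4 * (R ^ p) ^ 2)) := by
  set Z : κ → Ω → ℂ := fun k w => ∑ m, expMonomial p z (X (k, m) w) with hZ
  set N : ℝ := Fintype.card κ * Fintype.card β with hN
  have hcont := continuous_expMonomial p z
  have hbound (n : κ × β) : ∀ᵐ w ∂μ, ‖expMonomial p z (X n w)‖ ≤ R ^ p :=
    (hb n).mono fun w hw => norm_expMonomial_le p z hw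
  have hmeas (n : κ × β) : AEMeasurable (fun w => expMonomial p z (X n w)) μ :=
    hcont.measurable.comp_aemeasurable (hm n)
  have hmean (n : κ × β) : expMoment (μ.map (X n)) p z = ∫ w, expMonomial p z (X n w) ∂μ :=
    integral_map (hm n) hcont.aestronglyMeasurable
  have hsupp (n : κ × β) : ∀ᵐ x ∂μ.map (X n), |x| ≤ R :=
    (ae_map_iff (hm n) (measurableSet_le (by fun_prop) (by fun_prop))).mpr (hb n)
  have hsum (w : Ω) : ∑ k, (Z k w - μ[Z k]) = (N : ℂ) * (expMoment (empirical (X · w)) p z -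
      expMoment (mixture fun n => μ.map (X n)) p z) := by
    have hN0 : (N : ℂ) ≠ 0 := by simp [hN]
    have hcard : ((Fintype.card (κ × β) : ℕ) : ℂ) = N := by simp [hN]
    rw [expMoment_empirical, expMoment_mixture hsupp, ← sub_div, hcard, mul_div_cancel₀ _ hN0,
      Fintype.sum_prod_type, Fintype.sum_prod_type, ← Finset.sum_sub_distrib]
    refine Finset.sum_congr rfl fun k _ => ?_
    simp_rw [hmean, hZ]
    rw [integral_finsetSum _ fun m _ =>
      .of_bound (hmeas (k, m)).aestronglyMeasurable _ (hbound (k, m))]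
  have hhoeffding := measureReal_le_norm_sum_sub_integral_le (Z := Z) (R := Fintype.card β * R ^ p)
    (ε := N * ε)
    (hind.comp (fun _ x => ∑ m, expMonomial p z (x m)) fun _ =>
      Finset.measurable_sum _ fun m _ => hcont.measurable.comp (measurable_pi_apply m))
    (fun k => Finset.aemeasurable_fun_sum _ fun m _ => hmeas (k, m))
    (fun k => (ae_all_iff.mpr fun m => hbound (k, m)).mono fun w hw =>
      (norm_sum_le_of_le _ fun m _ => hw m).trans_eq (by simp))
    (by positivity)
  refine (measureReal_mono fun w hw => ?_).trans (hhoeffding.trans_eq ?_)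
  · rw [Set.mem_ofPred_eq, hsum, norm_mul, norm_real, Real.norm_of_nonneg (by positivity)]
    exact mul_le_mul_of_nonneg_left hw (by positivity)
  · rw [hN]
    congr 2
    field_simp

lemma measureReal_exists_le_norm_expMoment_empirical_sub_le
    (hind : iIndepFun (fun k w m => X (k, m) w) μ) (hm : ∀ n, AEMeasurable (X n) μ)
    (hb : ∀ n, ∀ᵐ w ∂μ, |X n w| ≤ R) (hR : 1 ≤ R) (hε : 0 ≤ ε) (q : ℕ) {L : ℕ}
    (ω : Fin L → ℝ) :
    μ.real {w | ∃ p ≤ q, ∃ l l', ε ≤ ‖expMoment (empirical (X · w)) p (ω l' - ω l) -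
        expMoment (mixture fun n => μ.map (X n)) p (ω l' - ω l)‖} ≤
      4 * (q + 1) * L ^ 2 * Real.exp (-(Fintype.card κ * ε ^ 2) / (4 * (R ^ q) ^ 2)) := by
  calc _ ≤ μ.real (⋃ j : Fin (q + 1) × Fin L × Fin L,
        {w | ε ≤ ‖expMoment (empirical (X · w)) j.1 (ω j.2.2 - ω j.2.1) -
          expMoment (mixture fun n => μ.map (X n)) j.1 (ω j.2.2 - ω j.2.1)‖}) := by
        refine measureReal_mono fun w ⟨p, hp, l, l', hw⟩ => ?_
        exact Set.mem_iUnion.mpr ⟨(⟨p, by omega⟩, l, l'), hw⟩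
    _ ≤ ∑ _j : Fin (q + 1) × Fin L × Fin L,
        4 * Real.exp (-(Fintype.card κ * ε ^ 2) / (4 * (R ^ q) ^ 2)) := by
        refine (measureReal_iUnion_fintype_le _).trans (Finset.sum_le_sum fun j _ => ?_)
        refine (measureReal_le_norm_expMoment_empirical_sub_le hind hm hb hε _ _).trans ?_
        rw [neg_div, neg_div]
        gcongr
        omega
    _ = _ := by
        simp
        ring

end MomentConcentration

section UniformAnchors

variable {Ω : Type*} [MeasurableSpace Ω] {μ : Measure Ω}

lemma map_div_eq_restrict_Icc_of_isUniform {X : Ω → ℝ} {D : ℝ} (hD : 0 < D)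
    (hX : pdf.IsUniform X (Set.Icc 0 D) μ volume) :
    μ.map (fun w => X w / D) = volume.restrict (Set.Icc 0 1) := by
  have hvol : volume (Set.Icc 0 D) = ENNReal.ofReal D := by rw [Real.volume_Icc, sub_zero]
  have hpos : ENNReal.ofReal D ≠ 0 := by simpa using hD
  have hm : AEMeasurable X μ :=
    hX.aemeasurable (by rwa [hvol]) (by simp [hvol])
  have hf : Measurable fun x : ℝ => D⁻¹ * x := measurable_const_mul _
  have hpre : (fun x : ℝ => D⁻¹ * x) ⁻¹' Set.Icc 0 1 = Set.Icc 0 D := by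
    simp [Set.preimage_const_mul_Icc₀ _ _ (inv_pos.mpr hD)]
  have hrestrict := Measure.restrict_map (μ := volume) hf
    (measurableSet_Icc (a := (0 : ℝ)) (b := 1))
  rw [hpre, Real.map_volume_mul_left (inv_ne_zero hD.ne'), inv_inv, abs_of_pos hD,
    Measure.restrict_smul] at hrestrict
  calc μ.map (fun w => X w / D) = (μ.map X).map (fun x => D⁻¹ * x) := by
        rw [AEMeasurable.map_map_of_aemeasurable hf.aemeasurable hm]
        simp only [Function.comp_def, div_eq_inv_mul]
    _ = volume.restrict (Set.Icc 0 1) := by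
        rw [hX, ProbabilityTheory.cond, Measure.map_smul, ← hrestrict, smul_smul, hvol,
          ENNReal.inv_mul_cancel hpos ENNReal.ofReal_ne_top, one_smul]

lemma aemeasurable_of_map_eq_restrict_Icc {U : Ω → ℝ}
    (hU : μ.map U = volume.restrict (Set.Icc 0 1)) : AEMeasurable U μ :=
  .of_map_ne_zero (by simp [hU])

lemma map_add_const_eq_restrict_Icc {U : Ω → ℝ} (hU : μ.map U = volume.restrict (Set.Icc 0 1))
    (a : ℝ) : μ.map (fun w => U w + a) = volume.restrict (Set.Icc a (a + 1)) := by
  have hm := aemeasurable_of_map_eq_restrict_Icc hU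
  have hmap := (measurePreserving_add_right (volume : Measure ℝ) a).restrict_preimage
    (measurableSet_Icc (a := a) (b := a + 1))
  rw [Set.preimage_add_const_Icc, sub_self, add_sub_cancel_left, ← hU] at hmap
  rw [← hmap.map_eq, AEMeasurable.map_map_of_aemeasurable hmap.aemeasurable hm]
  rfl

end UniformAnchors

section Scaling

variable {ι : Type*} {L T : ℕ} {D : ℝ}

lemma steering_smul_div (hD : D ≠ 0) (φ : ι → ℝ) (ω : Fin L → ℝ) :
    steering (fun n => φ n / D) (D • ω) = steering φ ω := by
  have hD' : (D : ℂ) ≠ 0 := ofReal_ne_zero.mpr hD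
  ext n l
  simp only [steering, of_apply, Pi.smul_apply, smul_eq_mul, ofReal_mul, ofReal_div]
  congr 1
  field_simp

lemma steeringDeriv_smul_div (hD : D ≠ 0) (φ : ι → ℝ) (ω : Fin L → ℝ) (s : Fin L → ℂ) :
    steeringDeriv (fun n => φ n / D) (D • ω) s = (D : ℂ)⁻¹ • steeringDeriv φ ω s := by
  ext n l
  have h := congrFun₂ (steering_smul_div hD φ ω) n l
  simp only [steering, of_apply] at h
  simp only [steeringDeriv, of_apply, Matrix.smul_apply, smul_eq_mul, h]
  rw [ofReal_div]
  ring

variable [Fintype ι] [DecidableEq ι]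

lemma fimFC_smul_div (hD : D ≠ 0) (φ : ι → ℝ) (ω : Fin L → ℝ) (s : Fin T → Fin L → ℂ) :
    fimFC (fun n => φ n / D) (D • ω) s = (D ^ 2)⁻¹ • fimFC φ ω s := by
  simp only [fimFC, projPerp, steeringDeriv_smul_div hD, steering_smul_div hD, Finset.smul_sum]
  refine Finset.sum_congr rfl fun i _ => ?_
  ext l l'
  rw [conjTranspose_smul, Matrix.smul_mul, Matrix.smul_mul, Matrix.mul_smul, smul_smul]
  simp only [map_apply, Matrix.smul_apply, smul_eq_mul, star_inv₀, RCLike.star_def, conj_ofReal]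
  rw [← ofReal_inv, ← ofReal_mul, re_ofReal_mul, sq, mul_inv]

lemma crbFC_smul_div (hD : D ≠ 0) (σ : ℝ) (φ : ι → ℝ) (ω : Fin L → ℝ) (s : Fin T → Fin L → ℂ) :
    crbFC σ (fun n => φ n / D) (D • ω) s = D ^ 2 • crbFC σ φ ω s := by
  rw [crbFC, crbFC, fimFC_smul_div hD, matrix_inv_smul (by positivity), inv_inv, smul_comm]

lemma smul_twoFreq (D ω₀ Δω : ℝ) : D • twoFreq ω₀ Δω = twoFreq (D * ω₀) (D * Δω) := by
  ext l
  fin_cases l <;> simp [twoFreq, mul_add]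

lemma avgCrbFC_div (hD : D ≠ 0) (σ : ℝ) (φ : ι → ℝ) (s : Fin T → Fin 2 → ℂ) (ω₀ Δω : ℝ) :
    avgCrbFC σ (fun n => φ n / D) s (D * ω₀) (D * Δω) = D ^ 2 * avgCrbFC σ φ s ω₀ Δω := by
  simp only [avgCrbFC, ← smul_twoFreq, crbFC_smul_div hD, Matrix.smul_apply, smul_eq_mul]
  ring

end Scaling

section SlopeBound

variable {ι : Type*} [Fintype ι] [DecidableEq ι] {T : ℕ} {σ ω₀ Δω b : ℝ} {φ : ι → ℝ}
  {s : Fin T → Fin 2 → ℂ}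

/-- The two sources are identifiable at separation `Δω`, and there the average Cramér–Rao bound has
a slope of size at most `b`. -/
def HasCrbSlopeLE (σ : ℝ) (φ : ι → ℝ) (s : Fin T → Fin 2 → ℂ) (ω₀ Δω b : ℝ) : Prop :=
  ((steering φ (twoFreq ω₀ Δω))ᴴ * steering φ (twoFreq ω₀ Δω)).det ≠ 0 ∧
    (fimFC φ (twoFreq ω₀ Δω) s).PosDef ∧
    ∃ d, HasDerivAt (fun x => avgCrbFC σ φ s ω₀ x) d Δω ∧ |d| ≤ b

lemma HasCrbSlopeLE.mono {b' : ℝ} (h : HasCrbSlopeLE σ φ s ω₀ Δω b) (hb : b ≤ b') :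
    HasCrbSlopeLE σ φ s ω₀ Δω b' :=
  ⟨h.1, h.2.1, h.2.2.imp fun _ hd => ⟨hd.1, hd.2.trans hb⟩⟩

lemma HasCrbSlopeLE.of_div {D : ℝ} (hD : 0 < D)
    (h : HasCrbSlopeLE σ (fun n => φ n / D) s (D * ω₀) (D * Δω) b) :
    HasCrbSlopeLE σ φ s ω₀ Δω (b / D) := by
  obtain ⟨hdet, hpos, d, hd, hdb⟩ := h
  rw [← smul_twoFreq, steering_smul_div hD.ne'] at hdet
  rw [← smul_twoFreq, fimFC_smul_div hD.ne'] at hpos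
  refine ⟨hdet, ?_, d / D, ?_, ?_⟩
  · simpa [smul_smul, hD.ne'] using hpos.smul (pow_pos hD 2)
  · have hchain : HasDerivAt (fun x => avgCrbFC σ (fun n => φ n / D) s (D * ω₀) (D * x)) (d * D)
        Δω := hd.comp Δω (by simpa using (hasDerivAt_id Δω).const_mul D)
    simp only [avgCrbFC_div hD.ne'] at hchain
    have hdiv := hchain.const_mul (D ^ 2)⁻¹
    simp only [inv_mul_cancel_left₀ (pow_ne_zero 2 hD.ne')] at hdiv
    exact hdiv.congr_deriv (by field_simp)
  · rw [abs_div, abs_of_pos hD]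
    gcongr

lemma hasDerivAt_twoFreq (ω₀ y : ℝ) (l : Fin 2) :
    HasDerivAt (twoFreq ω₀ · l) (![0, 1] l) y := by
  fin_cases l
  · exact hasDerivAt_const y ω₀
  · exact (hasDerivAt_id y).const_add ω₀

lemma IsLowerRieszBound.hasCrbSlopeLE [Nonempty ι] {y r R ε : ℝ} (hr : 0 < r)
    (h : IsLowerRieszBound (empirical φ) (twoFreq ω₀ y) r) (hφ : ∀ n, |φ n| ≤ R)
    (hs : ∀ l, 0 < sourcePower s l)
    (hε : ∀ p ≤ 2, ∀ l l', l ≠ l' →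
      ‖expMoment (empirical φ) (p + 1) (twoFreq ω₀ y l' - twoFreq ω₀ y l)‖ ≤ ε) (σ : ℝ) :
    HasCrbSlopeLE σ φ s ω₀ y (((1 + 4 * R / r) / r) ^ 2 *
      (σ ^ 2 / Fintype.card ι * (1 / sourcePower s 0 + 1 / sourcePower s 1)) * ε) := by
  have hε0 : 0 ≤ ε := (norm_nonneg _).trans (hε 0 zero_le_two 0 1 zero_ne_one)
  have hcross (p : ℕ) (hp : p ≤ 2) (l l' : Fin 2) : |(![0, 1] l' : ℝ) - ![0, 1] l| *
      ‖expMoment (empirical φ) (p + 1) (twoFreq ω₀ y l' - twoFreq ω₀ y l)‖ ≤ ε := by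
    rcases eq_or_ne l l' with rfl | hl
    · simpa using hε0
    · refine le_trans (mul_le_of_le_one_left (norm_nonneg _) ?_) (hε p hp l l' hl)
      fin_cases l <;> fin_cases l' <;> simp
  refine ⟨h.det_conjTranspose_steering_mul_self_ne_zero hr hφ, h.posDef_fimFC hr hφ hs, ?_⟩
  have hslope := h.exists_hasDerivAt_crbFC hr hφ (hasDerivAt_twoFreq ω₀ y) hε0 hcross σ hs
  obtain ⟨d₀, hd₀, hd₀'⟩ := hslope 0
  obtain ⟨d₁, hd₁, hd₁'⟩ := hslope 1
  refine ⟨(d₀ + d₁) / 2, (hd₀.add hd₁).div_const 2, ?_⟩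
  have hs₀ := hs 0
  have hs₁ := hs 1
  rw [abs_div, abs_two, div_le_iff₀ two_pos]
  refine (abs_add_le d₀ d₁).trans ((add_le_add hd₀' hd₁').trans_eq ?_)
  push_cast
  field_simp
  ring

end SlopeBound

section NominalArray

variable {ι : Type*} [Fintype ι] {φ ψ δ : ι → ℝ} {R A ε η : ℝ}

/-- The distribution of a uniformly chosen element of an array with displacements `δ` whose
subarrays are placed uniformly in the unit interval. -/
def nominalMeasure (δ : ι → ℝ) : Measure ℝ :=
  mixture fun n => volume.restrict (Set.Icc (δ n) (δ n + 1))

instance [Nonempty ι] : IsProbabilityMeasure (nominalMeasure δ) := by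
  unfold nominalMeasure
  infer_instance

lemma ae_nominalMeasure_abs_le (hδ : ∀ n, |δ n| ≤ A) :
    ∀ᵐ x ∂nominalMeasure δ, |x| ≤ A + 1 :=
  ae_mixture fun n => ae_restrict_Icc_abs_le (hδ n)

variable [Nonempty ι]

lemma norm_sum_div_card_le {f : ι → ℂ} {a : ℝ} (h : ∀ n, ‖f n‖ ≤ a) :
    ‖(∑ n, f n) / Fintype.card ι‖ ≤ a := by
  rw [norm_div, Complex.norm_natCast, div_le_iff₀' (Nat.cast_pos.mpr Fintype.card_pos)]
  exact (norm_sum_le_of_le _ fun n _ => h n).trans_eq (by simp)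

lemma abs_mul_norm_expMoment_nominalMeasure_le (hδ : ∀ n, |δ n| ≤ A) (p : ℕ) (z : ℝ) :
    |z| * ‖expMoment (nominalMeasure δ) p z‖ ≤ 2 * (A + 1) ^ p + p * (A + 1) ^ (p - 1) := by
  rcases eq_or_ne z 0 with rfl | hz
  · have hA : 0 ≤ A := (abs_nonneg _).trans (hδ (Classical.arbitrary ι))
    simpa using (by positivity)
  rw [← le_div_iff₀' (abs_pos.mpr hz), nominalMeasure,
    expMoment_mixture fun n => ae_restrict_Icc_abs_le (hδ n)]
  exact norm_sum_div_card_le fun n => (le_div_iff₀' (abs_pos.mpr hz)).mpr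
    (abs_mul_norm_expMoment_restrict_Icc_le p z (hδ n))

lemma norm_expMoment_empirical_sub_empirical_le (hφ : ∀ n, |φ n| ≤ R) (hψ : ∀ n, |ψ n| ≤ R)
    (h : ∀ n, |φ n - ψ n| ≤ η) (p : ℕ) (z : ℝ) :
    ‖expMoment (empirical φ) p z - expMoment (empirical ψ) p z‖ ≤
      (p * R ^ (p - 1) + |z| * R ^ p) * η := by
  have hR : 0 ≤ R := (abs_nonneg _).trans (hφ (Classical.arbitrary ι))
  rw [expMoment_empirical, expMoment_empirical, ← sub_div, ← Finset.sum_sub_distrib]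
  refine norm_sum_div_card_le fun n => (norm_expMonomial_sub_le p z (hφ n) (hψ n)).trans ?_
  gcongr
  exact h n

lemma IsLowerRieszBound.hasCrbSlopeLE_of_norm_expMoment_sub_le [DecidableEq ι] {T : ℕ}
    {r ω₀ y : ℝ} {s : Fin T → Fin 2 → ℂ} (hr : 0 < r) (hA : 0 ≤ A) (hδ : ∀ n, |δ n| ≤ A)
    (h : ∀ n, IsLowerRieszBound (volume.restrict (Set.Icc (δ n) (δ n + 1))) (twoFreq ω₀ y) r)
    (hφ : ∀ n, |φ n| ≤ A + 2) (hy : 0 < y) (hs : ∀ l, 0 < sourcePower s l) (hε : ε ≤ r / 8)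
    (hdev : ∀ p ≤ 3, ∀ l l', ‖expMoment (empirical φ) p (twoFreq ω₀ y l' - twoFreq ω₀ y l) -
      expMoment (nominalMeasure δ) p (twoFreq ω₀ y l' - twoFreq ω₀ y l)‖ ≤ ε) (σ : ℝ) :
    HasCrbSlopeLE σ φ s ω₀ y (((1 + 4 * (A + 2) / (r / 2)) / (r / 2)) ^ 2 *
      (σ ^ 2 / Fintype.card ι * (1 / sourcePower s 0 + 1 / sourcePower s 1)) *
      (ε + 5 * (A + 1) ^ 3 / y)) := by
  have hnominal : IsLowerRieszBound (nominalMeasure δ) (twoFreq ω₀ y) r :=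
    IsLowerRieszBound.mixture h fun n => ae_restrict_Icc_abs_le (hδ n)
  have hempirical : IsLowerRieszBound (empirical φ) (twoFreq ω₀ y) (r / 2) := by
    refine (hnominal.of_norm_expMoment_sub_le (R := A + 2) (κ := ε)
      ((ae_nominalMeasure_abs_le hδ).mono fun x hx => by linarith) (ae_empirical hφ)
      fun p hp l l' => ?_).mono ?_
    · rw [norm_sub_rev]
      exact hdev p (by omega) l l'
    · push_cast
      linarith
  refine hempirical.hasCrbSlopeLE (half_pos hr) hφ hs (fun p hp l l' hl => ?_) σ
  have hosc := abs_mul_norm_expMoment_nominalMeasure_le hδ (p + 1)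
    (twoFreq ω₀ y l' - twoFreq ω₀ y l)
  rw [abs_twoFreq_sub hl, abs_of_pos hy, ← le_div_iff₀' hy] at hosc
  have hpow : 2 * (A + 1) ^ (p + 1) + (p + 1 : ℕ) * (A + 1) ^ (p + 1 - 1) ≤ 5 * (A + 1) ^ 3 := by
    calc _ ≤ 2 * (A + 1) ^ 3 + (3 : ℕ) * (A + 1) ^ 3 := by gcongr <;> first | linarith | omega
      _ = _ := by push_cast; ring
  calc _ ≤ _ := norm_le_norm_sub_add _ (expMoment (nominalMeasure δ) (p + 1) _)
    _ ≤ ε + 5 * (A + 1) ^ 3 / y :=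
      add_le_add (hdev (p + 1) (by omega) l l') (hosc.trans (by gcongr))

lemma norm_expMoment_empirical_twoFreq_sub_le {y₀ y : ℝ} (hφ : ∀ n, |φ n| ≤ R)
    (hψ : ∀ n, |ψ n| ≤ R) (h : ∀ n, |φ n - ψ n| ≤ η) (hR : 1 ≤ R) (hy₀ : 0 < y₀) (hy : y₀ ≤ y)
    {p : ℕ} (hp : p ≤ 3) (ω₀ : ℝ) (l l' : Fin 2) :
    ‖expMoment (empirical φ) p (twoFreq ω₀ y l' - twoFreq ω₀ y l) -
        expMoment (empirical ψ) p (twoFreq ω₀ y l' - twoFreq ω₀ y l)‖ ≤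
      (3 / y₀ + 1) * R ^ 3 * (η * y) := by
  have hη : 0 ≤ η := (abs_nonneg _).trans (h (Classical.arbitrary ι))
  have hy' : 0 < y := hy₀.trans_le hy
  have hz : |twoFreq ω₀ y l' - twoFreq ω₀ y l| ≤ y := by
    rcases eq_or_ne l l' with rfl | hl
    · simpa using hy'.le
    · rw [abs_twoFreq_sub hl, abs_of_pos hy']
  have hone : 1 ≤ y / y₀ := (one_le_div hy₀).mpr hy
  calc _ ≤ (p * R ^ (p - 1) + |twoFreq ω₀ y l' - twoFreq ω₀ y l| * R ^ p) * η :=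
      norm_expMoment_empirical_sub_empirical_le hφ hψ h p _
    _ ≤ ((3 : ℕ) * R ^ 3 + y * R ^ 3) * η := by gcongr; omega
    _ ≤ ((3 : ℕ) * R ^ 3 * (y / y₀) + y * R ^ 3) * η :=
      mul_le_mul_of_nonneg_right
        (add_le_add (le_mul_of_one_le_right (by positivity) hone) le_rfl) hη
    _ = (3 / y₀ + 1) * R ^ 3 * (η * y) := by push_cast; ring

lemma IsLowerRieszBound.hasCrbSlopeLE_of_abs_sub_le [DecidableEq ι] {T : ℕ} {r ω₀ y₀ y : ℝ}
    {s : Fin T → Fin 2 → ℂ} (hr : 0 < r) (hA : 0 ≤ A) (hδ : ∀ n, |δ n| ≤ A)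
    (h : ∀ n, IsLowerRieszBound (volume.restrict (Set.Icc (δ n) (δ n + 1))) (twoFreq ω₀ y) r)
    (hφ : ∀ n, |φ n| ≤ A + 1) (hψ : ∀ n, |ψ n - φ n| ≤ η) (hη : η ≤ 1) (hy₀ : 0 < y₀)
    (hy : y₀ ≤ y) (hs : ∀ l, 0 < sourcePower s l)
    (hε : ε + (3 / y₀ + 1) * (A + 2) ^ 3 * (η * y) ≤ r / 8)
    (hdev : ∀ p ≤ 3, ∀ l l', ‖expMoment (empirical φ) p (twoFreq ω₀ y l' - twoFreq ω₀ y l) -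
      expMoment (nominalMeasure δ) p (twoFreq ω₀ y l' - twoFreq ω₀ y l)‖ ≤ ε) (σ : ℝ) :
    HasCrbSlopeLE σ ψ s ω₀ y (((1 + 4 * (A + 2) / (r / 2)) / (r / 2)) ^ 2 *
      (σ ^ 2 / Fintype.card ι * (1 / sourcePower s 0 + 1 / sourcePower s 1)) *
      (ε + (3 / y₀ + 1) * (A + 2) ^ 3 * (η * y) + 5 * (A + 1) ^ 3 / y)) := by
  have hψA (n : ι) : |ψ n| ≤ A + 2 := by
    have hn := abs_sub_abs_le_abs_sub (ψ n) (φ n)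
    linarith [hφ n, hψ n]
  refine hasCrbSlopeLE_of_norm_expMoment_sub_le hr hA hδ h hψA (hy₀.trans_le hy) hs hε
    (fun p hp l l' => ?_) σ
  rw [add_comm ε]
  exact (norm_sub_le_norm_sub_add_norm_sub _ _ _).trans (add_le_add
    (norm_expMoment_empirical_twoFreq_sub_le hψA (fun n => (hφ n).trans (by linarith)) hψ
      (by linarith) hy₀ hy hp ω₀ l l') (hdev p hp l l'))

end NominalArray

section Probability

variable {Ω : Type*} [MeasurableSpace Ω] {μ : Measure Ω} [IsProbabilityMeasure μ]
  {κ β : Type*} [Fintype κ] [Fintype β] [Nonempty β] {U : κ → Ω → ℝ} {δ : κ × β → ℝ} {A ε : ℝ}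

lemma measureReal_exists_le_norm_expMoment_sub_nominalMeasure_le [Nonempty κ] (hind : iIndepFun U μ)
    (hU : ∀ k, μ.map (U k) = volume.restrict (Set.Icc 0 1)) (hA : 0 ≤ A)
    (hδ : ∀ n, |δ n| ≤ A) (hε : 0 ≤ ε) (q : ℕ) {L : ℕ} (ω : Fin L → ℝ) :
    μ.real {w | ∃ p ≤ q, ∃ l l', ε ≤ ‖expMoment (empirical fun n => U n.1 w + δ n) p (ω l' - ω l) -
        expMoment (nominalMeasure δ) p (ω l' - ω l)‖} ≤
      4 * (q + 1) * L ^ 2 * Real.exp (-(Fintype.card κ * ε ^ 2) / (4 * ((A + 1) ^ q) ^ 2)) := by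
  have hm (k : κ) : AEMeasurable (U k) μ := aemeasurable_of_map_eq_restrict_Icc (hU k)
  have hmap (n : κ × β) : μ.map (fun w => U n.1 w + δ n) =
      volume.restrict (Set.Icc (δ n) (δ n + 1)) := map_add_const_eq_restrict_Icc (hU n.1) (δ n)
  have hXm (n : κ × β) : AEMeasurable (fun w => U n.1 w + δ n) μ := (hm n.1).add_const (δ n)
  have hconc := measureReal_exists_le_norm_expMoment_empirical_sub_le (R := A + 1)
    (X := fun n w => U n.1 w + δ n)
    (hind.comp (fun k u m => u + δ (k, m)) fun k => by fun_prop) hXm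
    (fun n => ae_of_ae_map (hXm n) (by rw [hmap]; exact ae_restrict_Icc_abs_le (hδ n)))
    (by linarith) hε q ω
  simp only [hmap] at hconc
  exact hconc

lemma measureReal_not_hasCrbSlopeLE_le [DecidableEq κ] [DecidableEq β] {T : ℕ}
    {r ω₀ y₀ y η : ℝ} {s : Fin T → Fin 2 → ℂ} {ψ : Ω → κ × β → ℝ} (hr : 0 < r) (hA : 0 ≤ A)
    (h : ∀ n, IsLowerRieszBound (volume.restrict (Set.Icc (δ n) (δ n + 1))) (twoFreq ω₀ y) r)
    (hind : iIndepFun U μ) (hU : ∀ k, μ.map (U k) = volume.restrict (Set.Icc 0 1))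
    (hδ : ∀ n, |δ n| ≤ A) (hψ : ∀ᵐ w ∂μ, ∀ n, |ψ w n - U n.1 w - δ n| ≤ η) (hη : η ≤ 1)
    (hy₀ : 0 < y₀) (hy : y₀ ≤ y) (hs : ∀ l, 0 < sourcePower s l) (hε0 : 0 ≤ ε)
    (hε : ε + (3 / y₀ + 1) * (A + 2) ^ 3 * (η * y) ≤ r / 8) (σ : ℝ) :
    μ.real {w | ¬HasCrbSlopeLE σ (ψ w) s ω₀ y (((1 + 4 * (A + 2) / (r / 2)) / (r / 2)) ^ 2 *
        (σ ^ 2 / Fintype.card (κ × β) * (1 / sourcePower s 0 + 1 / sourcePower s 1)) *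
        (ε + (3 / y₀ + 1) * (A + 2) ^ 3 * (η * y) + 5 * (A + 1) ^ 3 / y))} ≤
      64 * Real.exp (-(Fintype.card κ * ε ^ 2) / (4 * ((A + 1) ^ 3) ^ 2)) := by
  cases isEmpty_or_nonempty κ
  · exact measureReal_le_one.trans (by norm_num [Fintype.card_eq_zero])
  have hUIcc : ∀ᵐ w ∂μ, ∀ k, U k w ∈ Set.Icc (0 : ℝ) 1 := ae_all_iff.mpr fun k =>
    ae_of_ae_map (aemeasurable_of_map_eq_restrict_Icc (hU k))
      (by rw [hU]; exact ae_restrict_mem measurableSet_Icc)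
  have hconc := measureReal_exists_le_norm_expMoment_sub_nominalMeasure_le hind hU hA hδ hε0 3
    (twoFreq ω₀ y)
  refine (ENNReal.toReal_mono (measure_ne_top _ _) (measure_mono_ae ?_)).trans
    (hconc.trans_eq (by norm_num))
  filter_upwards [hψ, hUIcc] with w hψw hUw hslope
  by_contra hdev
  refine hslope (IsLowerRieszBound.hasCrbSlopeLE_of_abs_sub_le hr hA hδ h
    (φ := fun n => U n.1 w + δ n) (fun n => ?_) (fun n => ?_) hη hy₀ hy hs hε
    (fun p hp l l' => ?_) σ)
  · have hUn := hUw n.1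
    have hδn := abs_le.mp (hδ n)
    exact abs_le.mpr ⟨by linarith [hUn.1], by linarith [hUn.2]⟩
  · rw [← sub_sub]
    exact hψw n
  · by_contra! hlt
    exact hdev ⟨p, hp, l, l', hlt.le⟩

end Probability

lemma exists_pos_mul_add_mul_le {r Q : ℝ} (hr : 0 < r) (hQ : 0 < Q) :
    ∃ τ > 0, τ ≤ 1 ∧ ∃ c > 0, ∀ t x, t ≤ 1 → x ≤ c → τ * t + Q * x ≤ r := by
  refine ⟨min (r / 2) 1, by positivity, min_le_right _ _, r / 2 / Q, by positivity,
    fun t x ht hx => ?_⟩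
  have hτ : min (r / 2) 1 * t ≤ r / 2 :=
    (mul_le_of_le_one_right (by positivity) ht).trans (min_le_left _ _)
  rw [le_div_iff₀' hQ] at hx
  linarith

lemma mul_add_mul_add_mul_le {τ Q R t x u : ℝ} (hτ : τ ≤ 1) (hQ : 0 ≤ Q) (hR : 0 ≤ R) (ht : 0 ≤ t)
    (hx : 0 ≤ x) (hu : 0 ≤ u) : τ * t + Q * x + R * u ≤ (1 + Q + R) * (t + u + x) := by
  calc τ * t + Q * x + R * u
      ≤ τ * t + Q * x + R * u + ((1 - τ) * t + x + u + Q * (t + u) + R * (t + x)) :=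
        le_add_of_nonneg_right (by have := sub_nonneg.mpr hτ; positivity)
    _ = (1 + Q + R) * (t + u + x) := by ring

lemma exp_neg_mul_sq_div_le {k τ P c : ℝ} (hk : 0 ≤ k) (hc : c ≤ τ ^ 2 / P) (t : ℝ) :
    Real.exp (-(k * (τ * t) ^ 2) / P) ≤ Real.exp (-c * k * t ^ 2) := by
  rw [Real.exp_le_exp]
  calc -(k * (τ * t) ^ 2) / P = -(τ ^ 2 / P) * (k * t ^ 2) := by ring
    _ ≤ -c * (k * t ^ 2) := by gcongr
    _ = -c * k * t ^ 2 := by ring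

/-- The nominal moments are `O(1 / y)`, the concentration step is run with accuracy `τ t`, and the
displacements enter through `η y`. -/
theorem exists_measureReal_not_hasCrbSlopeLE_le {y₀ A : ℝ} (hy₀ : 0 < y₀) (hA : 0 ≤ A) :
    ∃ c > (0 : ℝ), ∃ C > (0 : ℝ),
      ∀ {Ω : Type*} [MeasurableSpace Ω] {μ : Measure Ω} [IsProbabilityMeasure μ]
        {κ β : Type*} [Fintype κ] [DecidableEq κ] [Fintype β] [DecidableEq β] [Nonempty β]
        {T : ℕ} {y η t : ℝ} {s : Fin T → Fin 2 → ℂ} {ψ : Ω → κ × β → ℝ} {U : κ → Ω → ℝ}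
        {δ : κ × β → ℝ} (σ ω₀ : ℝ),
        (∀ l, 0 < sourcePower s l) → iIndepFun U μ →
        (∀ k, μ.map (U k) = volume.restrict (Set.Icc 0 1)) → (∀ n, |δ n| ≤ A) →
        0 ≤ η → η * y ≤ c → (∀ᵐ w ∂μ, ∀ n, |ψ w n - U n.1 w - δ n| ≤ η) →
        y₀ ≤ y → 0 ≤ t → t ≤ 1 →
        μ.real {w | ¬HasCrbSlopeLE σ (ψ w) s ω₀ y
            (C * (σ ^ 2 / Fintype.card (κ × β) * (1 / sourcePower s 0 + 1 / sourcePower s 1)) *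
              (t + 1 / y + η * y))} ≤
          C * Real.exp (-c * Fintype.card κ * t ^ 2) := by
  obtain ⟨r, hr, hriesz⟩ := exists_isLowerRieszBound_twoFreq hy₀ hA
  set B : ℝ := ((1 + 4 * (A + 2) / (r / 2)) / (r / 2)) ^ 2 with hB
  set Q : ℝ := (3 / y₀ + 1) * (A + 2) ^ 3 with hQ
  obtain ⟨τ, hτ, hτ1, c₀, hc₀, hsmall⟩ :=
    exists_pos_mul_add_mul_le (show 0 < r / 8 by positivity) (show 0 < Q by positivity)
  set R : ℝ := 5 * (A + 1) ^ 3 with hR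
  set c : ℝ := min (min c₀ y₀) (τ ^ 2 / (4 * ((A + 1) ^ 3) ^ 2))
  have hcc₀ : c ≤ c₀ := (min_le_left _ _).trans (min_le_left _ _)
  have hcy₀ : c ≤ y₀ := (min_le_left _ _).trans (min_le_right _ _)
  set C : ℝ := max 64 (B * (1 + Q + R))
  refine ⟨c, by positivity, C, by positivity, ?_⟩
  intro Ω _ μ _ κ β _ _ _ _ _ T y η t s ψ U δ σ ω₀ hs hind hU hδ hη hηc hψ hy ht ht1
  have hy' : 0 < y := hy₀.trans_le hy
  have hη1 : η ≤ 1 := le_of_mul_le_mul_right (by linarith) hy'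
  have hbound := measureReal_not_hasCrbSlopeLE_le hr hA (fun n => hriesz y hy (δ n) (hδ n) ω₀)
    hind hU hδ hψ hη1 hy₀ hy hs (by positivity) (hsmall t (η * y) ht1 (hηc.trans hcc₀)) σ
  rw [← hB, ← hQ, ← hR] at hbound
  refine (measureReal_mono fun w => mt fun hslope => hslope.mono ?_).trans
    (hbound.trans (mul_le_mul (le_max_left _ _)
      (exp_neg_mul_sq_div_le (Nat.cast_nonneg _) (min_le_right _ _) t) (Real.exp_nonneg _)
      (by positivity)))
  have hs0 := hs 0
  have hs1 := hs 1
  calc _ ≤ B * (σ ^ 2 / Fintype.card (κ × β) * (1 / sourcePower s 0 + 1 / sourcePower s 1)) *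
        ((1 + Q + R) * (t + 1 / y + η * y)) := by
        rw [div_eq_mul_one_div R]
        gcongr
        exact mul_add_mul_add_mul_le hτ1 (by positivity) (by positivity) ht (by positivity)
          (by positivity)
    _ = B * (1 + Q + R) * (σ ^ 2 / Fintype.card (κ × β) *
        (1 / sourcePower s 0 + 1 / sourcePower s 1)) * (t + 1 / y + η * y) := by ring
    _ ≤ _ := by gcongr; exact le_max_right _ _

lemma sourcePower_pos {L T : ℕ} {s : Fin T → Fin L → ℂ} {l : Fin L} (h : ∃ i, s i l ≠ 0) :
    0 < sourcePower s l := by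
  obtain ⟨i, hi⟩ := h
  exact Finset.sum_pos' (fun _ _ => by positivity) ⟨i, Finset.mem_univ i, by positivity⟩

theorem proposition3_general {y₀ A : ℝ} (hy₀ : 0 < y₀) (hA : 0 ≤ A) :
    ∃ c > (0 : ℝ), ∃ C > (0 : ℝ),
      ∀ {Ω : Type*} [MeasurableSpace Ω] {μ : Measure Ω} [IsProbabilityMeasure μ]
        {κ β : Type*} [Fintype κ] [DecidableEq κ] [Fintype β] [DecidableEq β] [Nonempty β]
        {T : ℕ} {D Δω η t : ℝ} {s : Fin T → Fin 2 → ℂ} {φ : Ω → κ × β → ℝ} {X : κ → Ω → ℝ}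
        {δ : κ × β → ℝ} (σ ω₀ : ℝ),
        0 < D → (∀ l, ∃ i, s i l ≠ 0) → iIndepFun X μ →
        (∀ k, pdf.IsUniform (X k) (Set.Icc 0 D) μ volume) → (∀ n, |δ n| ≤ A * D) →
        0 ≤ η → η * (Δω * D) ≤ c →
        (∀ᵐ w ∂μ, ∀ n, |φ w n - X n.1 w - δ n| ≤ η * D) →
        y₀ / D ≤ Δω → 0 ≤ t → t ≤ 1 →
        μ.real {w | ¬HasCrbSlopeLE σ (φ w) s ω₀ Δω
            (C * (σ ^ 2 / (Fintype.card (κ × β) * D) *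
              (1 / sourcePower s 0 + 1 / sourcePower s 1)) *
              (t + 1 / (Δω * D) + η * (Δω * D)))} ≤
          C * Real.exp (-c * Fintype.card κ * t ^ 2) := by
  obtain ⟨c, hc, C, hC, h⟩ := exists_measureReal_not_hasCrbSlopeLE_le hy₀ hA
  refine ⟨c, hc, C, hC, ?_⟩
  intro Ω _ μ _ κ β _ _ _ _ _ T D Δω η t s φ X δ σ ω₀ hD hs hind hX hδ hη hηc hφ hΔω ht ht1
  have hunit := h (y := D * Δω) (ψ := fun w n => φ w n / D) (U := fun k w => X k w / D)
    (δ := fun n => δ n / D) σ (D * ω₀) (fun l => sourcePower_pos (hs l))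
    (hind.comp (fun _ x => x / D) fun _ => by fun_prop)
    (fun k => map_div_eq_restrict_Icc_of_isUniform hD (hX k))
    (fun n => by rw [abs_div, abs_of_pos hD]; exact (div_le_iff₀ hD).mpr (hδ n))
    hη (by rwa [mul_comm D])
    (hφ.mono fun w hw n => by
      rw [← sub_div, ← sub_div, abs_div, abs_of_pos hD]
      exact (div_le_iff₀ hD).mpr (hw n))
    ((div_le_iff₀' hD).mp hΔω) ht ht1
  refine (measureReal_mono fun w => mt fun hslope => ?_).trans hunit
  convert hslope.of_div hD using 1
  rw [mul_comm D]
  field_simp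

end ArrayCRB

end

open ArrayCRB MeasureTheory ProbabilityTheory Matrix in
theorem proposition3 :
    ∃ c > (0 : ℝ), ∃ C > (0 : ℝ),
      ∀ (Ω : Type*) [MeasurableSpace Ω] (μ : Measure Ω) [IsProbabilityMeasure μ]
        (K M T : ℕ) (D σ ω₀ Δω η t : ℝ) (s : Fin T → Fin 2 → ℂ)
        (φ : Ω → Fin K × Fin M → ℝ) (δ : Fin K × Fin M → ℝ),
        0 < M → 0 < D → 0 < σ →
        (∀ l, ∃ i, s i l ≠ 0) →
        iIndepFun (fun (k : Fin K) (w : Ω) => subarrayMean (φ w) k) μ →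
        (∀ k : Fin K, pdf.IsUniform (fun w => subarrayMean (φ w) k) (Set.Icc 0 D) μ volume) →
        (∀ n, |δ n| ≤ D) →
        0 ≤ η → η * (Δω * D) ≤ c →
        (∀ᵐ w ∂μ, ∀ n, |φ w n - subarrayMean (φ w) n.1 - δ n| ≤ η * D) →
        2 * Real.pi / D ≤ Δω →
        0 < t → t ≤ 1 →
        μ.real {w | ¬ (((steering (φ w) (twoFreq ω₀ Δω))ᴴ *
                steering (φ w) (twoFreq ω₀ Δω)).det ≠ 0 ∧
              (fimFC (φ w) (twoFreq ω₀ Δω) s).PosDef ∧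
              ∃ d : ℝ, HasDerivAt (fun x => avgCrbFC σ (φ w) s ω₀ x) d Δω ∧
                |d| ≤ C * (σ ^ 2 / ((K * M : ℕ) * D) *
                    (1 / sourcePower s 0 + 1 / sourcePower s 1)) *
                  (t + 1 / (Δω * D) + η * (Δω * D)))}
          ≤ C * Real.exp (-c * K * t ^ 2) := by
  obtain ⟨c, hc, C, hC, h⟩ := proposition3_general Real.two_pi_pos zero_le_one
  refine ⟨c, hc, C, hC, fun Ω _ μ _ K M T D σ ω₀ Δω η t s φ δ hM hD _ hs hind hunif hδ hη hηc
    hφ hΔω ht ht1 => ?_⟩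
  have : Nonempty (Fin M) := ⟨⟨0, hM⟩⟩
  simpa only [HasCrbSlopeLE, Fintype.card_prod, Fintype.card_fin] using h σ ω₀ hD hs hind hunif
    (by simpa only [one_mul] using hδ) hη hηc hφ hΔω ht.le ht1
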